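/- **Theorem (Fast convergence of on-policy DPO).** *Setting.* Let $\mathcal X,\mathcal A$ be finite sets, $\mathcal D$ a probability distribution on $\mathcal X$, $\pi_0:\mathcal X\to\Delta(\mathcal A)$ a base policy, $\phi:\mathcal X\times\mathcal A\to\mathbb R^d$ a feature map with $\|\phi(x,a)\|_2\le 1$, $r^*:\mathcal X\times\mathcal A\to\mathbb R$ a reward function, $\gamma>0$, $R>0$ and $p\in[1,2]$. Put $\sigma(z)=1/(1+e^{-z})$, $\mathbb P_*(a^1\succ a^2\mid x)=\sigma(r^*(x,a^1)-r^*(x,a^2))$, $\pi_\theta(a|x)\propto\pi_0(a|x)e^{\theta^\top\phi(x,a)}$ for $\theta\in\mathbb R^d$, $\pi^*(a|x)\propto\pi_0(a|x)e^{r^*(x,a)/\gamma}$, and let $B_p(\theta_0,r)$ be the closed $L^p$-ball in $\mathbb R^d$. Write $\mathrm{KL}(\pi\|\pi')=\mathbb E_{x\sim\mathcal D}\mathrm{KL}(\pi(x)\|\pi'(x))$. For a policy $\pi$ let $$\mathbb V(\pi)=\mathbb E_{x\sim\mathcal D,\,a\sim\pi(x)}\big[(\phi(x,a)-\mathbb E_{b\sim\pi(x)}\phi(x,b))^{\otimes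 2}\big],\qquad C_{\pi\to\pi'}=\inf\{C>0:\mathbb V(\pi')\preceq C\,\mathbb V(\pi)\},$$ and $C_*^p(r)=\sup\{C_{\pi_\theta\to\pi^*}:\theta\in B_p(\theta^*,r)\}$, where $\theta^*$ is the parameter below. *Algorithm (on-policy DPO with batch size $n$).* Start with $\hat\theta_0=0$. In round $k=0,1,\dots,K-1$ draw, given the past, $n$ independent samples: $x\sim\mathcal D$, $a^1,a^2\sim\hat\pi_k(x)$ independently, where $\hat\pi_k=\pi_{\hat\theta_k}$, and set $(a^+,a^-)=(a^1,a^2)$ with probability $\mathbb P_*(a^1\succ a^2\mid x)$ and $(a^+,a^-)=(a^2,a^1)$ otherwise. Let $\hat\theta_{k+1}$ be any minimizer, over $\theta\in B_q(0,R)$, of $$\sum_{(x,a^+,a^-)}-\ln\sigma\Big(\gamma\ln\tfrac{\pi_\theta(a^+|x)}{\pi_\theta(a^-|x)}-\gamma\ln\tfrac{\pi_0(a^+|x)}{\pi_0(a^-|x)}\Big),$$ the sum being over the samples of round $k$. Here $q=2$ or $q=p$ (the theorem holds for both), and ties are broken by an arbitrary rule that may depend on all batches drawn so far. The output is $\hat\theta_K$,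 $\hat\pi_K=\pi_{\hat\theta_K}$. *Assumptions.* (i) $\pi^*=\pi_{\theta^*}$ for some $\theta^*\in B_p(0,R)$. (ii) $\mathbb V(\pi^*)\succeq\lambda I_d$ for some $\lambda>0$. (iii) Either $r\mapsto\sqrt{C_*^p(r)}$ is convex on $[0,R]$, or, for a given $\kappa\ge1$, the set $\{r\in(0,R]:C_*^p(r)/r^2\le\kappa\,C_*^p(R)/R^2\}$ is an interval that contains some $r\le 1$. *Claim.* For all $c_0>0$ and $\kappa\ge1$ there is a constant $c>0$, depending only on $c_0$ and $\kappa$, such that the following holds in every setting as above, for all $\eta,\delta\in(0,1)$ and $K\in\mathbb N$. Suppose $\min\{\sqrt{C_*^p(R)},R\}\ge c_0/\gamma$ and put $$\xi_n=\frac{52\,e^{4\gamma R}d^{2/p}}{\lambda\eta^2n}\,\ln\frac{9\gamma RKn}{\delta}\qquad(\text{with the convention } \ln 0=0 \text{ if } K=0).$$ Let runs of $K$ rounds of on-policy DPO with batch sizes $n=0,1,2,\dots$ be given on a common probability space, with an arbitrary joint distribution. Then with probability at least $1-\delta$, for all $n$ such that $\gamma Rn\ge1$ and $\xi_n\le c/C_*^p(R)$,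 the output of the run with batch size $n$ satisfies $$\mathrm{KL}(\hat\pi_K\|\pi^*)\le\|\hat\theta_K-\theta^*\|_p^2\le\max\Big\{\frac{e^2}{\gamma^2}\,\xi_n,\;R^2\eta^{2K}\Big\}.$$ -/

import Mathlib

open scoped ENNReal

universe u v w

noncomputable section

namespace OnPolicyDPO

/-- The `L^p` norm of a vector in `ℝ^d`. -/
abbrev lpNorm {d : ℕ} (p : ℝ≥0∞) (v : Fin d → ℝ) : ℝ :=
  ‖(WithLp.toLp p v : PiLp p (fun _ : Fin d => ℝ))‖

/-- The closed `L^p` ball with centre `c` and radius `r` in `ℝ^d`. -/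
def lpBall {d : ℕ} (p : ℝ≥0∞) (c : Fin d → ℝ) (r : ℝ) : Set (Fin d → ℝ) :=
  {θ | lpNorm p (θ - c) ≤ r}

/-- A contextual bandit with finite prompt space `X` and finite response space `A`: prompt
distribution, base policy, features in the Euclidean unit ball of `ℝ^d`, reward function and
regularization parameter. -/
structure Bandit (X : Type u) (A : Type v) [Fintype X] [Fintype A] (d : ℕ) where
  /-- the prompt distribution -/
  prompt : X → ℝ
  prompt_mem : prompt ∈ stdSimplex ℝ X
  /-- the base policy: `base x a` is the probability of the response `a` to the prompt `x` -/
  base : X → A → ℝ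
  base_mem : ∀ x, base x ∈ stdSimplex ℝ A
  /-- the feature map -/
  feature : X → A → Fin d → ℝ
  feature_norm : ∀ x a, lpNorm 2 (feature x a) ≤ 1
  /-- the reward function of the Bradley-Terry model -/
  reward : X → A → ℝ
  /-- the regularization parameter -/
  γ : ℝ
  γ_pos : 0 < γ

/-- A labelled comparison `(x, a¹, a², y)`; the label `y = true` means that `a¹` is preferred. -/
abbrev Sample (X : Type u) (A : Type v) : Type (max u v) := X × A × A × Bool

namespace Sample

variable {X : Type u} {A : Type v}

/-- The prompt. -/
def prompt (s : Sample X A) : X := s.1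

/-- The preferred response `a⁺`. -/
def win (s : Sample X A) : A := if s.2.2.2 then s.2.1 else s.2.2.1

/-- The dispreferred response `a⁻`. -/
def lose (s : Sample X A) : A := if s.2.2.2 then s.2.2.1 else s.2.1

end Sample

namespace Bandit

variable {X : Type u} {A : Type v} [Fintype X] [Fintype A] {d : ℕ} (M : Bandit X A d)

/-- The policy `π(a|x) ∝ π₀(a|x) exp (f(x,a))`. -/
def tilt (f : X → A → ℝ) (x : X) (a : A) : ℝ :=
  M.base x a * Real.exp (f x a) / ∑ b, M.base x b * Real.exp (f x b)

/-- The linear softmax policy `π_θ(a|x) ∝ π₀(a|x) exp (θᵀ φ(x,a))`. -/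
def policy (θ : Fin d → ℝ) : X → A → ℝ :=
  M.tilt fun x a => θ ⬝ᵥ M.feature x a

/-- The target policy `π*(a|x) ∝ π₀(a|x) exp (r*(x,a)/γ)`. -/
def target : X → A → ℝ :=
  M.tilt fun x a => M.reward x a / M.γ

/-- The Bradley-Terry preference probability `P_*(a¹ ≻ a² | x)`. -/
def prefProb (x : X) (a₁ a₂ : A) : ℝ :=
  Real.sigmoid (M.reward x a₁ - M.reward x a₂)

/-- The mean feature `E_{a ∼ π(x)} φ(x,a)`. -/
def meanFeature (π : X → A → ℝ) (x : X) : Fin d → ℝ :=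
  ∑ a, π x a • M.feature x a

/-- The feature covariance matrix `V(π)`. -/
def cov (π : X → A → ℝ) : Matrix (Fin d) (Fin d) ℝ :=
  ∑ x, M.prompt x • ∑ a, π x a •
    Matrix.vecMulVec (M.feature x a - M.meanFeature π x) (M.feature x a - M.meanFeature π x)

/-- The coverage of `π'` by `π`: the infimum of all `C > 0` with `V(π') ⪯ C V(π)`. -/
def coverage (π π' : X → A → ℝ) : ℝ :=
  sInf {C : ℝ | 0 < C ∧ (C • M.cov π - M.cov π').PosSemidef}

/-- The local `L^p`-coverage of the target policy: the supremum of the coverage of the target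
policy by `π_θ` over all `θ` in the closed `L^p` ball of radius `r` around `θs`. -/
def localCoverage (p : ℝ≥0∞) (θs : Fin d → ℝ) (r : ℝ) : ℝ :=
  sSup ((fun θ => M.coverage (M.policy θ) M.target) '' lpBall p θs r)

/-- The KL divergence `E_{x ∼ D} KL(π(x) ‖ π'(x))` of two policies with the same support. -/
def kl (π π' : X → A → ℝ) : ℝ :=
  ∑ x, M.prompt x * ∑ a, π x a * Real.log (π x a / π' x a)

/-- The probability of a sample: `x` is drawn from the prompt distribution, `a¹` and `a²`
independently from `π(x)`, and the label from the Bradley-Terry model. -/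
def sampleProb (π : X → A → ℝ) (s : Sample X A) : ℝ :=
  match s with
  | (x, a₁, a₂, y) => M.prompt x * π x a₁ * π x a₂ *
      (if y then M.prefProb x a₁ a₂ else 1 - M.prefProb x a₁ a₂)

/-- The probability of a data set of `n` independent samples. -/
def dataProb {n : ℕ} (π : X → A → ℝ) (D : Fin n → Sample X A) : ℝ :=
  ∏ i, M.sampleProb π (D i)

/-- The DPO objective of the policy `π` on the data set `D`. -/
def dpoLoss {n : ℕ} (π : X → A → ℝ) (D : Fin n → Sample X A) : ℝ :=
  ∑ i, -Real.log (Real.sigmoid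
    (M.γ * Real.log (π (D i).prompt (D i).win / π (D i).prompt (D i).lose)
      - M.γ * Real.log (M.base (D i).prompt (D i).win / M.base (D i).prompt (D i).lose)))

/-- `est k (D₀, …, D_{k-1})` is the parameter of the policy after `k` rounds of on-policy DPO over
the parameter set `Θ` with batch size `n`: it starts with the base policy and is in each round a
minimizer over `Θ` of the DPO objective on the newest batch. Ties may be broken arbitrarily,
depending on all previous batches. -/
structure IsOnPolicyDPO (Θ : Set (Fin d → ℝ)) (n : ℕ)
    (est : (k : ℕ) → (Fin k → Fin n → Sample X A) → Fin d → ℝ) : Prop where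
  init : ∀ h, est 0 h = 0
  mem : ∀ k h, est (k + 1) h ∈ Θ
  isMin : ∀ k h, IsMinOn (fun θ => M.dpoLoss (M.policy θ) (h (Fin.last k))) Θ (est (k + 1) h)

/-- The probability that `K` rounds produce the batches `h = (D₀, …, D_{K-1})`, where the batch
`D_k` is sampled from the policy with parameter `est k (D₀, …, D_{k-1})`. -/
def runProb {n K : ℕ} (est : (k : ℕ) → (Fin k → Fin n → Sample X A) → Fin d → ℝ)
    (h : Fin K → Fin n → Sample X A) : ℝ :=
  ∏ k : Fin K, M.dataProb (M.policy (est k (fun j : Fin k => h (Fin.castLE k.2.le j)))) (h k)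

/-- The radii `r ∈ (0, R]` with `C(r)/r² ≤ κ C(R)/R²`, for the local coverage `C`. -/
def slowRadii (p : ℝ≥0∞) (θs : Fin d → ℝ) (R κ : ℝ) : Set ℝ :=
  {r | r ∈ Set.Ioc 0 R ∧
    M.localCoverage p θs r / r ^ 2 ≤ κ * (M.localCoverage p θs R / R ^ 2)}

/-- The growth condition on the local coverage: either its square root is convex on `[0, R]`, or
the set of radii with `C(r)/r² ≤ κ C(R)/R²` is an interval that reaches down to a radius at
most `1`. -/
def CoverageGrowth (p : ℝ≥0∞) (θs : Fin d → ℝ) (R κ : ℝ) : Prop :=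
  ConvexOn ℝ (Set.Icc 0 R) (fun r => √(M.localCoverage p θs r)) ∨
    ((M.slowRadii p θs R κ).OrdConnected ∧ ∃ r ∈ M.slowRadii p θs R κ, r ≤ 1)

/-- The statistical rate `ξ_n`. -/
def rate (p : ℝ≥0∞) (R lam η δ : ℝ) (K n : ℕ) : ℝ :=
  52 * Real.exp (4 * M.γ * R) * (d : ℝ) ^ (2 / p.toReal) / (lam * η ^ 2 * n) *
    Real.log (9 * M.γ * R * K * n / δ)

end Bandit

end OnPolicyDPO

end

/-! On data of positive probability the normalizers of the softmax policies cancel, so each round is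
constrained maximum likelihood in a logistic model whose logit is `γ` times a linear form in the
feature difference. By realizability the true logits have the same form with parameter `θs`
(`reward_sub_eq`, `sampleProb_policy`).

For a fixed parameter `t`, the expected product of square-root likelihood ratios is the `n`-th power
of a Hellinger affinity. That affinity is at most `exp(-γ² Var(t - θs) / (16 e^{2γR}))`, where `Var`
is the quadratic form of the feature covariance of the sampling policy
(`sum_sampleProb_mul_sqrt_le`). Markov's inequality, a union bound over a net of mesh `1/(γn)` and
Lipschitz continuity of the log-likelihood bound `Var` at the error of the estimator by order
`e^{2γR} (d log) / (γ² n)` (`featureVar_le_of_not_isAtypical`).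

Coverage transfers this bound to the covariance of the target, the lower bound `lam` turns it into a
Euclidean one, and comparing norms costs `d^(2/p - 1)`. With `r_k` the `L^p` distance to `θs` and
`C` the local coverage, a typical round gives `r_{k+1}² ≤ η² ξ_n C(r_k) / γ²`
(`lpNorm_sq_le_of_not_isAtypical`). A better policy thus collects better data. The growth condition
makes this map contract squared errors by `η²` until the floor `e² ξ_n / γ²` takes over
(`sq_le_max_of_recursion`).

The failure probability is split as `δ / (K n (n + 1))` over rounds and batch sizes, so only the law
of each run matters, not their joint law. The KL bound is the quadratic bound on the log-partition
function (`kl_policy_le`). -/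

namespace OnPolicyDPO

open Finset

/-! ### Comparison of `L^p` norms and Euclidean nets. -/

section Norms

variable {d : ℕ}

lemma lpNorm_zero {p : ℝ≥0∞} (hp : 1 ≤ p) : lpNorm p (0 : Fin d → ℝ) = 0 := by
  have : Fact (1 ≤ p) := ⟨hp⟩
  rw [lpNorm, WithLp.toLp_zero, norm_zero]

lemma lpNorm_two_sq (v : Fin d → ℝ) : lpNorm 2 v ^ 2 = ∑ i, v i ^ 2 := by
  simp [lpNorm, PiLp.norm_sq_eq_of_L2]

lemma abs_dotProduct_le (v w : Fin d → ℝ) : |v ⬝ᵥ w| ≤ lpNorm 2 v * lpNorm 2 w := by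
  have h := abs_real_inner_le_norm (WithLp.toLp 2 w : EuclideanSpace ℝ (Fin d)) (WithLp.toLp 2 v)
  simpa [EuclideanSpace.inner_toLp_toLp, mul_comm] using h

lemma abs_dotProduct_le_of_unit (v w : Fin d → ℝ) (hw : lpNorm 2 w ≤ 1) :
    |v ⬝ᵥ w| ≤ lpNorm 2 v :=
  (abs_dotProduct_le v w).trans (mul_le_of_le_one_right (norm_nonneg _) hw)

lemma one_le_toReal {p : ℝ≥0∞} (hp : 1 ≤ p) (hp2 : p ≤ 2) : 1 ≤ p.toReal := by
  have := ENNReal.toReal_mono (ne_top_of_le_ne_top (by simp) hp2) hp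
  simpa using this

lemma toReal_le_two {p : ℝ≥0∞} (hp2 : p ≤ 2) : p.toReal ≤ 2 := by
  have := ENNReal.toReal_mono (by simp) hp2
  simpa using this

lemma lpNorm_eq {p : ℝ≥0∞} (hp : 1 ≤ p) (hp2 : p ≤ 2) (v : Fin d → ℝ) :
    lpNorm p v = (∑ i, |v i| ^ p.toReal) ^ (1 / p.toReal) := by
  have h1 := one_le_toReal hp hp2
  simp [lpNorm, PiLp.norm_eq_sum (p := p) (by linarith)]

/-- Every coordinate is at most the `L^p` norm `N`, so `v i ^ 2` is at most `|v i|^p N^(2-p)`; then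
sum. -/
lemma lpNorm_two_le {p : ℝ≥0∞} (hp : 1 ≤ p) (hp2 : p ≤ 2) (v : Fin d → ℝ) :
    lpNorm 2 v ≤ lpNorm p v := by
  have h1 := one_le_toReal hp hp2
  have h2 := toReal_le_two hp2
  have : Fact (1 ≤ p) := ⟨hp⟩
  set N := lpNorm p v with hN
  have hN0 : 0 ≤ N := norm_nonneg _
  have hi (i) : |v i| ≤ N := by
    simpa using PiLp.norm_apply_le (WithLp.toLp p v : PiLp p (fun _ : Fin d => ℝ)) i
  have hsum : ∑ i, |v i| ^ p.toReal = N ^ p.toReal := by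
    rw [hN, lpNorm_eq hp hp2, ← Real.rpow_mul (by positivity),
      one_div_mul_cancel (by linarith), Real.rpow_one]
  refine (sq_le_sq₀ (norm_nonneg _) hN0).1 ?_
  rw [lpNorm_two_sq]
  calc ∑ i, v i ^ 2 ≤ ∑ i, |v i| ^ p.toReal * N ^ (2 - p.toReal) := by
        refine sum_le_sum fun i _ => ?_
        have : v i ^ 2 = |v i| ^ p.toReal * |v i| ^ (2 - p.toReal) := by
          rw [← Real.rpow_add_of_nonneg (abs_nonneg _) (by linarith) (by linarith)]
          norm_num
        rw [this]
        exact mul_le_mul_of_nonneg_left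
          (Real.rpow_le_rpow (abs_nonneg _) (hi i) (by linarith)) (by positivity)
    _ = N ^ 2 := by
        rw [← sum_mul, hsum, ← Real.rpow_add_of_nonneg hN0 (by linarith) (by linarith)]
        norm_num

/-- Power mean inequality with exponent `2/p ≥ 1`. The factor `d^(2/p - 1)` times the `d` from the
entropy of the net is the `d^(2/p)` of the rate. -/
lemma lpNorm_sq_le {p : ℝ≥0∞} (hp : 1 ≤ p) (hp2 : p ≤ 2) (v : Fin d → ℝ) :
    lpNorm p v ^ 2 ≤ (d : ℝ) ^ (2 / p.toReal - 1) * lpNorm 2 v ^ 2 := by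
  have h1 := one_le_toReal hp hp2
  have h2 := toReal_le_two hp2
  have h3 : 1 ≤ 2 / p.toReal := by rw [le_div_iff₀] <;> linarith
  have h := Real.rpow_sum_le_const_mul_sum_rpow (s := univ) (fun i => |v i| ^ p.toReal) h3
  have h0 (i) : |(|v i| ^ p.toReal)| = |v i| ^ p.toReal := abs_of_nonneg (by positivity)
  simp only [h0, card_univ, Fintype.card_fin] at h
  have h4 (i) : (|v i| ^ p.toReal) ^ (2 / p.toReal) = v i ^ 2 := by
    rw [← Real.rpow_mul (abs_nonneg _), mul_div_cancel₀ _ (by linarith)]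
    norm_num
  simp only [h4] at h
  rw [lpNorm_two_sq, lpNorm_eq hp hp2, ← Real.rpow_natCast, ← Real.rpow_mul (by positivity)]
  convert h using 2
  push_cast
  ring

lemma lpBall_subset {q : ℝ≥0∞} (hq : 1 ≤ q) (hq2 : q ≤ 2) (c : Fin d → ℝ) (r : ℝ) :
    lpBall q c r ⊆ lpBall 2 c r :=
  fun _ h => (lpNorm_two_le hq hq2 _).trans h

lemma lpNorm_two_le_of_abs_le {v : Fin d → ℝ} {t : ℝ} (ht : 0 ≤ t) (h : ∀ i, |v i| ≤ t) :
    lpNorm 2 v ≤ √d * t := by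
  refine (sq_le_sq₀ (norm_nonneg _) (by positivity)).1 ?_
  rw [lpNorm_two_sq, mul_pow, Real.sq_sqrt (by positivity)]
  calc ∑ i, v i ^ 2 ≤ ∑ _i : Fin d, t ^ 2 := sum_le_sum fun i _ => sq_le_sq.2 (by
        rw [abs_of_nonneg ht]; exact h i)
    _ = d * t ^ 2 := by simp

/-- A Euclidean ball has an `ε`-net of its own points of size at most `(2 R √d / ε + 2) ^ d`. -/
lemma exists_net (d : ℕ) {R ε : ℝ} (hR : 0 < R) (hε : 0 < ε) :
    ∃ T : Finset (Fin d → ℝ), (∀ t ∈ T, lpNorm 2 t ≤ R) ∧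
      (T.card : ℝ) ≤ (2 * R * √d / ε + 2) ^ d ∧
      ∀ θ, lpNorm 2 θ ≤ R → ∃ t ∈ T, lpNorm 2 (θ - t) ≤ ε := by
  classical
  set m := ⌈2 * R * √d / ε⌉₊ with hm
  have hmle : (m : ℝ) + 1 ≤ 2 * R * √d / ε + 2 := by
    have := (Nat.ceil_lt_add_one (a := 2 * R * √d / ε) (by positivity)).le
    linarith
  by_cases hd : d = 0
  · subst hd
    refine ⟨{0}, by simp [-Matrix.zero_empty, lpNorm_zero one_le_two, hR.le], by simp,
      fun θ _ => ⟨0, by simp, ?_⟩⟩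
    rw [Subsingleton.elim (θ - 0) 0, lpNorm_zero one_le_two]
    exact hε.le
  have hd' : 0 < (d : ℝ) := by positivity
  have hm0 : 0 < (m : ℝ) := by
    have : 0 < 2 * R * √d / ε := by positivity
    exact_mod_cast Nat.ceil_pos.2 this
  -- Grid cells of side `2R/m`. There are `m + 1` indices per axis because the coordinate value `R`
  -- has floor `m`.
  let cell : (Fin d → ℝ) → Fin d → Fin (m + 1) := fun θ i =>
    Fin.ofNat (m + 1) ⌊(θ i + R) * m / (2 * R)⌋₊
  have hcoord (θ : Fin d → ℝ) (hθ : lpNorm 2 θ ≤ R) (i) : |θ i| ≤ R := by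
    have := PiLp.norm_apply_le (WithLp.toLp 2 θ : PiLp 2 (fun _ : Fin d => ℝ)) i
    exact le_trans (by simpa using this) hθ
  have hcell (θ : Fin d → ℝ) (hθ : lpNorm 2 θ ≤ R) (i) :
      ((cell θ i : ℕ) : ℝ) ≤ (θ i + R) * m / (2 * R) ∧
      (θ i + R) * m / (2 * R) < (cell θ i : ℕ) + 1 := by
    have h1 := abs_le.1 (hcoord θ hθ i)
    have h0 : 0 ≤ (θ i + R) * m / (2 * R) := by
      have : 0 ≤ θ i + R := by linarith
      positivity
    have h2 : (θ i + R) * m / (2 * R) ≤ m := by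
      rw [div_le_iff₀ (by positivity)]
      nlinarith
    have h3 : ⌊(θ i + R) * m / (2 * R)⌋₊ < m + 1 := by
      have : ⌊(θ i + R) * m / (2 * R)⌋₊ ≤ m := by
        exact_mod_cast (Nat.floor_le h0).trans h2
      omega
    have h4 : (cell θ i : ℕ) = ⌊(θ i + R) * m / (2 * R)⌋₊ := by
      simp [cell, Fin.ofNat, Nat.mod_eq_of_lt h3]
    rw [h4]
    exact ⟨Nat.floor_le h0, Nat.lt_floor_add_one _⟩
  -- One point of the ball per nonempty cell, not the cell centre, so that the net stays inside the
  -- ball, where the logit bounds hold.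
  let rep : (Fin d → Fin (m + 1)) → Fin d → ℝ := fun g =>
    if h : ∃ θ, lpNorm 2 θ ≤ R ∧ cell θ = g then h.choose else 0
  refine ⟨univ.image rep, ?_, ?_, fun θ hθ => ⟨rep (cell θ), by simp, ?_⟩⟩
  · intro t ht
    obtain ⟨g, -, rfl⟩ := mem_image.1 ht
    by_cases h : ∃ θ, lpNorm 2 θ ≤ R ∧ cell θ = g
    · simp only [rep, dif_pos h]
      exact h.choose_spec.1
    · simp only [rep, dif_neg h, lpNorm_zero one_le_two, hR.le]
  · calc ((univ.image rep).card : ℝ) ≤ ((m + 1) ^ d : ℕ) := by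
          exact_mod_cast card_image_le.trans (by simp)
      _ ≤ _ := by
          push_cast
          gcongr
  · have h : ∃ θ', lpNorm 2 θ' ≤ R ∧ cell θ' = cell θ := ⟨θ, hθ, rfl⟩
    have hrep : rep (cell θ) = h.choose := by simp only [rep, dif_pos h]
    obtain ⟨h1, h2⟩ := h.choose_spec
    rw [← hrep] at h1 h2
    refine (lpNorm_two_le_of_abs_le (t := 2 * R / m) (by positivity) fun i => ?_).trans ?_
    · have ha := hcell θ hθ i
      have hb := hcell _ h1 i
      rw [h2] at hb
      have e : (θ - rep (cell θ)) i =
          ((θ i + R) * m / (2 * R) - (rep (cell θ) i + R) * m / (2 * R)) * (2 * R / m) := by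
        simp only [Pi.sub_apply]
        field_simp
        ring
      rw [e, abs_mul, abs_of_pos (a := 2 * R / m) (by positivity)]
      refine mul_le_of_le_one_left (by positivity) ?_
      rw [abs_le]
      constructor <;> linarith [ha.1, ha.2, hb.1, hb.2]
    · have := Nat.le_ceil (2 * R * √d / ε)
      rw [← hm, div_le_iff₀ hε] at this
      rw [← mul_div_assoc, div_le_iff₀ hm0]
      linarith

end Norms

/-! ### Inequalities for the logistic function and for exponential moments. -/

section Scalar

/-- The logarithm of the sigmoid is 1-Lipschitz; this controls the passage from an estimator to its
net point. -/
lemma sigmoid_le_exp_mul (u v : ℝ) : Real.sigmoid v ≤ Real.exp |u - v| * Real.sigmoid u := by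
  rw [Real.sigmoid_def, Real.sigmoid_def, ← div_eq_mul_inv, le_div_iff₀ (by positivity),
    ← div_eq_inv_mul, div_le_iff₀ (by positivity), mul_add, mul_one, ← Real.exp_add]
  have h1 : 1 ≤ Real.exp |u - v| := Real.one_le_exp (abs_nonneg _)
  have h2 : Real.exp (-u) ≤ Real.exp (|u - v| + -v) :=
    Real.exp_le_exp.2 (by linarith [neg_abs_le (u - v)])
  linarith

lemma one_add_sq_div_two_le_cosh (x : ℝ) : 1 + x ^ 2 / 2 ≤ Real.cosh x := by
  have h1 := Real.cosh_two_mul (x / 2)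
  have h2 : Real.cosh (x / 2) ^ 2 = 1 + Real.sinh (x / 2) ^ 2 := by
    linarith [Real.cosh_sq (x / 2)]
  have h3 : (x / 2) ^ 2 ≤ Real.sinh (x / 2) ^ 2 := by
    rw [sq_le_sq, Real.abs_sinh]
    exact Real.self_le_sinh_iff.2 (abs_nonneg _)
  rw [mul_div_cancel₀ x two_ne_zero] at h1
  nlinarith

/-- In this symmetric form the two labels share the denominator `cosh (u / 2)`. -/
lemma sigmoid_eq_exp_div_cosh (u : ℝ) :
    Real.sigmoid u = Real.exp (u / 2) / (2 * Real.cosh (u / 2)) := by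
  rw [Real.sigmoid_def, Real.cosh_eq, eq_div_iff (by positivity), ← div_eq_inv_mul,
    div_eq_iff (by positivity), mul_add, mul_one, ← Real.exp_add]
  have : u / 2 + -u = -(u / 2) := by ring
  rw [this]
  ring

/-- The Bhattacharyya coefficient of two Bernoulli distributions in logistic parametrization. -/
lemma sqrt_sigmoid_mul_add_le {u v B : ℝ} (hu : |u| ≤ 2 * B) (hv : |v| ≤ 2 * B) :
    √(Real.sigmoid u * Real.sigmoid v) + √(Real.sigmoid (-u) * Real.sigmoid (-v)) ≤
      1 - (u - v) ^ 2 / (32 * Real.exp (2 * B)) := by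
  set S := √(Real.sigmoid u * Real.sigmoid v) + √(Real.sigmoid (-u) * Real.sigmoid (-v)) with hS
  set Q := 4 * (Real.cosh (u / 2) * Real.cosh (v / 2)) with hQ
  have hQ0 : 0 < Q := by positivity
  have hQle : Q ≤ 4 * Real.exp (2 * B) := by
    have hc (w : ℝ) (hw : |w| ≤ 2 * B) : Real.cosh (w / 2) ≤ Real.exp B := by
      have h1 : Real.cosh (w / 2) ≤ Real.exp |w / 2| := by
        rw [← Real.cosh_abs, Real.cosh_eq]
        have : Real.exp (-|w / 2|) ≤ Real.exp |w / 2| :=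
          Real.exp_le_exp.2 (by linarith [abs_nonneg (w / 2)])
        linarith
      refine h1.trans (Real.exp_le_exp.2 ?_)
      rw [abs_div, abs_two]
      linarith
    have h2 : Real.exp (2 * B) = Real.exp B * Real.exp B := by rw [← Real.exp_add]; ring_nf
    rw [h2]
    have := mul_le_mul (hc u hu) (hc v hv) (by positivity) (by positivity)
    linarith
  have hpos : Real.sigmoid u * Real.sigmoid v = Real.exp ((u + v) / 2) / Q := by
    rw [sigmoid_eq_exp_div_cosh, sigmoid_eq_exp_div_cosh, div_mul_div_comm, ← Real.exp_add,
      hQ]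
    ring_nf
  have hneg : Real.sigmoid (-u) * Real.sigmoid (-v) = Real.exp (-((u + v) / 2)) / Q := by
    rw [sigmoid_eq_exp_div_cosh, sigmoid_eq_exp_div_cosh, div_mul_div_comm, ← Real.exp_add,
      neg_div, neg_div, Real.cosh_neg, Real.cosh_neg, hQ]
    ring_nf
  have hS2 : S ^ 2 = (2 * Real.cosh ((u + v) / 2) + 2) / Q := by
    have h1 : √(Real.sigmoid u * Real.sigmoid v) * √(Real.sigmoid (-u) * Real.sigmoid (-v)) =
        1 / Q := by
      rw [← Real.sqrt_mul (mul_nonneg (Real.sigmoid_nonneg _) (Real.sigmoid_nonneg _)), hpos, hneg,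
        div_mul_div_comm, ← Real.exp_add, add_neg_cancel, Real.exp_zero, ← pow_two Q,
        Real.sqrt_div zero_le_one, Real.sqrt_sq hQ0.le, Real.sqrt_one]
    rw [hS, add_sq, Real.sq_sqrt (mul_nonneg (Real.sigmoid_nonneg _) (Real.sigmoid_nonneg _)),
      Real.sq_sqrt (mul_nonneg (Real.sigmoid_nonneg _) (Real.sigmoid_nonneg _)), mul_assoc, h1,
      hpos, hneg, Real.cosh_eq]
    ring
  -- Comparing with `hS2`, the terms in `u + v` cancel and `1 - S²` depends on `u - v` alone, up to
  -- the factor `1/Q`.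
  have hprod : Q = 2 * Real.cosh ((u + v) / 2) + 2 * Real.cosh ((u - v) / 2) := by
    have e1 : (u + v) / 2 = u / 2 + v / 2 := by ring
    have e2 : (u - v) / 2 = u / 2 - v / 2 := by ring
    rw [hQ, e1, e2, Real.cosh_add, Real.cosh_sub]
    ring
  have h1S : (u - v) ^ 2 / (16 * Real.exp (2 * B)) ≤ 1 - S ^ 2 := by
    have e : 1 - S ^ 2 = (2 * Real.cosh ((u - v) / 2) - 2) / Q := by
      rw [hS2, eq_div_iff hQ0.ne', sub_mul, div_mul_cancel₀ _ hQ0.ne']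
      linarith
    have h2 := one_add_sq_div_two_le_cosh ((u - v) / 2)
    have h3 : (u - v) ^ 2 / 4 ≤ 2 * Real.cosh ((u - v) / 2) - 2 := by nlinarith
    rw [e]
    calc (u - v) ^ 2 / (16 * Real.exp (2 * B)) = (u - v) ^ 2 / 4 / (4 * Real.exp (2 * B)) := by
          rw [div_div]; ring_nf
      _ ≤ _ := div_le_div₀ (by nlinarith [sq_nonneg (u - v)]) h3 hQ0 hQle
  have h2 : (u - v) ^ 2 / (32 * Real.exp (2 * B)) =
      (u - v) ^ 2 / (16 * Real.exp (2 * B)) / 2 := by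
    rw [div_div]; ring_nf
  rw [h2]
  -- Uses `S ≤ (1 + S²) / 2`, which costs the factor two between 16 and 32.
  nlinarith [sq_nonneg (S - 1)]

/-- The mean of the exponential of a random variable with values in `[-s, s]`. -/
lemma log_sum_mul_exp_sub_le {ι : Type*} [Fintype ι] {π g : ι → ℝ} {s : ℝ}
    (hπ : π ∈ stdSimplex ℝ ι) (hg : ∀ i, |g i| ≤ s) :
    Real.log (∑ i, π i * Real.exp (g i)) - ∑ i, π i * g i ≤ s ^ 2 := by
  have h0 := hπ.1
  have h1 := hπ.2
  have hneg : Real.exp (-∑ i, π i * g i) ≤ ∑ i, π i * Real.exp (-g i) := by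
    have := convexOn_exp.map_sum_le (t := univ) (w := π) (p := fun i => -g i)
      (fun i _ => h0 i) h1 (fun _ _ => Set.mem_univ _)
    simpa [smul_eq_mul] using this
  have hpos : 0 < ∑ i, π i * Real.exp (g i) := by
    have h2 : ∃ i ∈ univ, 0 < π i := by
      by_contra! h
      have := sum_nonpos h
      linarith
    obtain ⟨i, hi, hi'⟩ := h2
    exact sum_pos' (fun j _ => mul_nonneg (h0 j) (Real.exp_pos _).le)
      ⟨i, hi, mul_pos hi' (Real.exp_pos _)⟩
  have hcosh : ∑ i, π i * Real.cosh (g i) ≤ Real.cosh s := by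
    calc _ ≤ ∑ i, π i * Real.cosh s := by
          refine sum_le_sum fun i _ => mul_le_mul_of_nonneg_left ?_ (h0 i)
          exact Real.cosh_le_cosh.2 ((hg i).trans (le_abs_self s))
      _ = _ := by rw [← sum_mul, h1, one_mul]
  have hcosh0 : 0 ≤ ∑ i, π i * Real.cosh (g i) :=
    sum_nonneg fun i _ => mul_nonneg (h0 i) (Real.cosh_pos _).le
  -- The product is `(E cosh g)² - (E sinh g)²`, hence at most `cosh² s`. Together with Jensen for
  -- `-g` this bounds the centred exponential moment.
  have hprod : (∑ i, π i * Real.exp (g i)) * (∑ i, π i * Real.exp (-g i)) ≤ Real.exp (s ^ 2) := by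
    have e1 : ∑ i, π i * Real.exp (g i) =
        (∑ i, π i * Real.cosh (g i)) + ∑ i, π i * Real.sinh (g i) := by
      rw [← sum_add_distrib]
      exact sum_congr rfl fun i _ => by rw [← mul_add, Real.cosh_add_sinh]
    have e2 : ∑ i, π i * Real.exp (-g i) =
        (∑ i, π i * Real.cosh (g i)) - ∑ i, π i * Real.sinh (g i) := by
      rw [← sum_sub_distrib]
      exact sum_congr rfl fun i _ => by rw [← mul_sub, Real.cosh_sub_sinh]
    have e3 : Real.cosh s ^ 2 ≤ Real.exp (s ^ 2) := by
      calc Real.cosh s ^ 2 ≤ Real.exp (s ^ 2 / 2) ^ 2 := by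
            gcongr
            exact Real.cosh_le_exp_half_sq s
        _ = _ := by rw [← Real.exp_nat_mul]; ring_nf
    rw [e1, e2]
    nlinarith [sq_nonneg (∑ i, π i * Real.sinh (g i)), pow_le_pow_left₀ hcosh0 hcosh 2]
  have h3 : (∑ i, π i * Real.exp (g i)) * Real.exp (-∑ i, π i * g i) ≤ Real.exp (s ^ 2) :=
    (mul_le_mul_of_nonneg_left hneg hpos.le).trans hprod
  have h4 := Real.log_le_log (mul_pos hpos (Real.exp_pos _)) h3
  rw [Real.log_mul hpos.ne' (Real.exp_pos _).ne', Real.log_exp, Real.log_exp] at h4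
  linarith

end Scalar

/-! ### Feature variance, coverage and KL divergence of softmax policies. -/

namespace Bandit

variable {X : Type u} {A : Type v} [Fintype X] [Fintype A] {d : ℕ} (M : Bandit X A d)

/-- The variance of `v ⬝ᵥ φ` under the policy `π`, averaged over prompts: the quadratic form of
the feature covariance. -/
noncomputable def featureVar (π : X → A → ℝ) (v : Fin d → ℝ) : ℝ :=
  ∑ x, M.prompt x *
    ∑ a, π x a * (v ⬝ᵥ M.feature x a - ∑ b, π x b * (v ⬝ᵥ M.feature x b)) ^ 2

lemma dotProduct_meanFeature (π : X → A → ℝ) (v : Fin d → ℝ) (x : X) :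
    v ⬝ᵥ M.meanFeature π x = ∑ b, π x b * (v ⬝ᵥ M.feature x b) := by
  simp [meanFeature, dotProduct_sum, dotProduct_smul]

lemma dotProduct_cov_mulVec (π : X → A → ℝ) (v : Fin d → ℝ) :
    v ⬝ᵥ (M.cov π).mulVec v = M.featureVar π v := by
  simp only [cov, featureVar, Matrix.sum_mulVec, Matrix.smul_mulVec, dotProduct_sum,
    dotProduct_smul, smul_eq_mul, Matrix.vecMulVec_mulVec]
  refine sum_congr rfl fun x _ => congrArg _ (sum_congr rfl fun a _ => congrArg _ ?_)
  rw [← dotProduct_meanFeature, ← dotProduct_sub]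
  simp [dotProduct_comm v, sq]

lemma cov_isHermitian (π : X → A → ℝ) : (M.cov π).IsHermitian := by
  ext i j
  simp only [Matrix.conjTranspose_apply, cov, Matrix.sum_apply, Matrix.smul_apply, smul_eq_mul,
    Matrix.vecMulVec_apply, star_trivial]
  exact sum_congr rfl fun x _ => congrArg _ (sum_congr rfl fun a _ => congrArg _ (mul_comm _ _))

lemma posSemidef_smul_cov_sub_iff (C : ℝ) (π π' : X → A → ℝ) :
    (C • M.cov π - M.cov π').PosSemidef ↔
      ∀ v, M.featureVar π' v ≤ C * M.featureVar π v := by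
  rw [Matrix.posSemidef_iff_dotProduct_mulVec]
  have h : (C • M.cov π - M.cov π').IsHermitian :=
    ((M.cov_isHermitian π).smul (k := C) (by simp [IsSelfAdjoint])).sub (M.cov_isHermitian π')
  simp only [h, true_and, star_trivial, Matrix.sub_mulVec, Matrix.smul_mulVec, dotProduct_sub,
    dotProduct_smul, dotProduct_cov_mulVec, smul_eq_mul, sub_nonneg]

lemma normalizer_pos (f : X → A → ℝ) (x : X) : 0 < ∑ b, M.base x b * Real.exp (f x b) := by
  have h0 := (M.base_mem x).1
  obtain ⟨i, hi, hi'⟩ : ∃ i ∈ univ, 0 < M.base x i := by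
    by_contra! h
    have := sum_nonpos h
    linarith [(M.base_mem x).2]
  exact sum_pos' (fun j _ => mul_nonneg (h0 j) (Real.exp_pos _).le)
    ⟨i, hi, mul_pos hi' (Real.exp_pos _)⟩

lemma tilt_mem (f : X → A → ℝ) (x : X) : M.tilt f x ∈ stdSimplex ℝ A := by
  refine ⟨fun a => div_nonneg (mul_nonneg ((M.base_mem x).1 a) (Real.exp_pos _).le)
    (M.normalizer_pos f x).le, ?_⟩
  simp only [tilt]
  rw [← sum_div, div_self (M.normalizer_pos f x).ne']

lemma policy_mem (θ : Fin d → ℝ) (x : X) : M.policy θ x ∈ stdSimplex ℝ A := M.tilt_mem _ x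

lemma abs_dotProduct_feature_le (v : Fin d → ℝ) (x : X) (a : A) :
    |v ⬝ᵥ M.feature x a| ≤ lpNorm 2 v :=
  abs_dotProduct_le_of_unit v _ (M.feature_norm x a)

lemma policy_le_exp_mul (θ θ' : Fin d → ℝ) {r : ℝ} (h : lpNorm 2 (θ - θ') ≤ r) (x : X) (a : A) :
    M.policy θ' x a ≤ Real.exp (2 * r) * M.policy θ x a := by
  have hd (b : A) : |θ ⬝ᵥ M.feature x b - θ' ⬝ᵥ M.feature x b| ≤ r := by
    rw [← sub_dotProduct]
    exact (M.abs_dotProduct_feature_le _ x b).trans h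
  have h0 := (M.base_mem x).1
  have hZ : ∑ b, M.base x b * Real.exp (θ ⬝ᵥ M.feature x b) ≤
      Real.exp r * ∑ b, M.base x b * Real.exp (θ' ⬝ᵥ M.feature x b) := by
    rw [mul_sum]
    refine sum_le_sum fun b _ => ?_
    rw [mul_left_comm, ← Real.exp_add]
    exact mul_le_mul_of_nonneg_left
      (Real.exp_le_exp.2 (by linarith [(abs_le.1 (hd b)).2])) (h0 b)
  have hp := M.normalizer_pos (fun x a => θ ⬝ᵥ M.feature x a) x
  have hp' := M.normalizer_pos (fun x a => θ' ⬝ᵥ M.feature x a) x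
  have hN : M.base x a * Real.exp (θ' ⬝ᵥ M.feature x a) ≤
      Real.exp r * (M.base x a * Real.exp (θ ⬝ᵥ M.feature x a)) := by
    rw [mul_left_comm, ← Real.exp_add]
    exact mul_le_mul_of_nonneg_left
      (Real.exp_le_exp.2 (by linarith [(abs_le.1 (hd a)).1])) (h0 a)
  have he : Real.exp (2 * r) = Real.exp r * Real.exp r := by rw [← Real.exp_add]; ring_nf
  simp only [policy, tilt]
  rw [he, ← mul_div_assoc, div_le_div_iff₀ hp' hp]
  calc _ ≤ (Real.exp r * (M.base x a * Real.exp (θ ⬝ᵥ M.feature x a))) *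
        (Real.exp r * ∑ b, M.base x b * Real.exp (θ' ⬝ᵥ M.feature x b)) :=
        mul_le_mul hN hZ hp.le
          (mul_nonneg (Real.exp_pos _).le (mul_nonneg (h0 a) (Real.exp_pos _).le))
    _ = _ := by ring

lemma sum_mul_sub_mean_sq {ι : Type*} [Fintype ι] {π : ι → ℝ} (hπ : π ∈ stdSimplex ℝ ι)
    (g : ι → ℝ) (c : ℝ) :
    ∑ i, π i * (g i - c) ^ 2 =
      ∑ i, π i * (g i - ∑ j, π j * g j) ^ 2 + (∑ j, π j * g j - c) ^ 2 := by
  set m := ∑ j, π j * g j with hm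
  have e (i) : π i * (g i - c) ^ 2 = π i * (g i - m) ^ 2 + 2 * (m - c) * (π i * g i)
      + ((m - c) ^ 2 - 2 * (m - c) * m) * π i := by ring
  rw [sum_congr rfl fun i _ => e i, sum_add_distrib, sum_add_distrib, ← mul_sum, ← mul_sum, hπ.2,
    ← hm]
  ring

lemma sum_sum_mul_sub_sq {ι : Type*} [Fintype ι] {π : ι → ℝ} (hπ : π ∈ stdSimplex ℝ ι)
    (g : ι → ℝ) :
    ∑ i, ∑ j, π i * π j * (g i - g j) ^ 2 =
      2 * ∑ i, π i * (g i - ∑ j, π j * g j) ^ 2 := by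
  have h (j) : ∑ i, π i * π j * (g i - g j) ^ 2 =
      π j * (∑ i, π i * (g i - ∑ j, π j * g j) ^ 2) + π j * (g j - ∑ j, π j * g j) ^ 2 := by
    rw [sub_sq_comm (g j), ← mul_add, ← sum_mul_sub_mean_sq hπ g (g j), mul_sum]
    exact sum_congr rfl fun i _ => by ring
  rw [sum_comm, sum_congr rfl fun j _ => h j, sum_add_distrib, ← sum_mul, hπ.2]
  ring

lemma featureVar_nonneg {π : X → A → ℝ} (hπ : ∀ x, π x ∈ stdSimplex ℝ A) (v : Fin d → ℝ) :
    0 ≤ M.featureVar π v :=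
  sum_nonneg fun x _ => mul_nonneg (M.prompt_mem.1 x)
    (sum_nonneg fun a _ => mul_nonneg ((hπ x).1 a) (sq_nonneg _))

lemma featureVar_le_sq {π : X → A → ℝ} (hπ : ∀ x, π x ∈ stdSimplex ℝ A) (v : Fin d → ℝ) :
    M.featureVar π v ≤ lpNorm 2 v ^ 2 := by
  calc M.featureVar π v ≤ ∑ x, M.prompt x * lpNorm 2 v ^ 2 := by
        refine sum_le_sum fun x _ => mul_le_mul_of_nonneg_left ?_ (M.prompt_mem.1 x)
        have h := sum_mul_sub_mean_sq (hπ x) (fun a => v ⬝ᵥ M.feature x a) 0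
        calc _ ≤ ∑ a, π x a * (v ⬝ᵥ M.feature x a - 0) ^ 2 := by
              rw [h]
              exact le_add_of_nonneg_right (sq_nonneg _)
          _ ≤ ∑ a, π x a * lpNorm 2 v ^ 2 := by
              refine sum_le_sum fun a _ => mul_le_mul_of_nonneg_left ?_ ((hπ x).1 a)
              rw [sub_zero, sq_le_sq, abs_of_nonneg (a := lpNorm 2 v) (norm_nonneg _)]
              exact M.abs_dotProduct_feature_le v x a
          _ = _ := by rw [← sum_mul, (hπ x).2, one_mul]
    _ = _ := by rw [← sum_mul, M.prompt_mem.2, one_mul]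

/-- Young's inequality with weight `1/100`. The discretization error may carry a large factor
because it is of second order, while the main term loses only one percent. -/
lemma featureVar_add_le {π : X → A → ℝ} (hπ : ∀ x, π x ∈ stdSimplex ℝ A) (u v : Fin d → ℝ) :
    M.featureVar π (u + v) ≤ 1.01 * M.featureVar π u + 101 * M.featureVar π v := by
  simp only [featureVar, mul_sum, ← sum_add_distrib]
  refine sum_le_sum fun x _ => sum_le_sum fun a _ => ?_
  have e : ∑ b, π x b * ((u + v) ⬝ᵥ M.feature x b) =
      ∑ b, π x b * (u ⬝ᵥ M.feature x b) + ∑ b, π x b * (v ⬝ᵥ M.feature x b) := by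
    rw [← sum_add_distrib]
    exact sum_congr rfl fun b _ => by rw [add_dotProduct, mul_add]
  rw [e, add_dotProduct]
  set a₁ := u ⬝ᵥ M.feature x a - ∑ b, π x b * (u ⬝ᵥ M.feature x b)
  set a₂ := v ⬝ᵥ M.feature x a - ∑ b, π x b * (v ⬝ᵥ M.feature x b)
  have h : (u ⬝ᵥ M.feature x a + v ⬝ᵥ M.feature x a -
      (∑ b, π x b * (u ⬝ᵥ M.feature x b) + ∑ b, π x b * (v ⬝ᵥ M.feature x b))) = a₁ + a₂ := by
    simp only [a₁, a₂]; ring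
  rw [h]
  have h1 : (a₁ + a₂) ^ 2 ≤ 1.01 * a₁ ^ 2 + 101 * a₂ ^ 2 := by
    nlinarith [sq_nonneg (a₁ / 10 - 10 * a₂)]
  calc _ ≤ M.prompt x * (π x a * (1.01 * a₁ ^ 2 + 101 * a₂ ^ 2)) := by
        have := M.prompt_mem.1 x
        have := (hπ x).1 a
        gcongr
    _ = _ := by ring

/-- Recentring at the mean under the other policy can only increase the variance; then the density
ratio bound applies. -/
lemma featureVar_policy_le (θ θ' : Fin d → ℝ) {r : ℝ} (h : lpNorm 2 (θ - θ') ≤ r)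
    (v : Fin d → ℝ) :
    M.featureVar (M.policy θ') v ≤ Real.exp (2 * r) * M.featureVar (M.policy θ) v := by
  simp only [featureVar, mul_sum (a := Real.exp (2 * r))]
  refine sum_le_sum fun x _ => ?_
  rw [mul_left_comm]
  refine mul_le_mul_of_nonneg_left ?_ (M.prompt_mem.1 x)
  have h1 := sum_mul_sub_mean_sq (M.policy_mem θ' x) (fun a => v ⬝ᵥ M.feature x a)
    (∑ b, M.policy θ x b * (v ⬝ᵥ M.feature x b))
  calc _ ≤ ∑ a, M.policy θ' x a *
        (v ⬝ᵥ M.feature x a - ∑ b, M.policy θ x b * (v ⬝ᵥ M.feature x b)) ^ 2 := by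
        rw [h1]
        exact le_add_of_nonneg_right (sq_nonneg _)
    _ ≤ _ := by
        rw [mul_sum]
        refine sum_le_sum fun a _ => ?_
        rw [← mul_assoc]
        exact mul_le_mul_of_nonneg_right (M.policy_le_exp_mul θ θ' h x a) (sq_nonneg _)

lemma coverage_nonneg (π π' : X → A → ℝ) : 0 ≤ M.coverage π π' :=
  Real.sInf_nonneg fun _ h => h.1.le

lemma coverage_le {π π' : X → A → ℝ} {C : ℝ} (hC : 0 < C)
    (h : ∀ v, M.featureVar π' v ≤ C * M.featureVar π v) : M.coverage π π' ≤ C :=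
  csInf_le ⟨0, fun _ h => h.1.le⟩ ⟨hC, (M.posSemidef_smul_cov_sub_iff C π π').2 h⟩

/-- The infimum itself is admissible in the variance inequality. Some admissible `C` is required
since `sInf ∅ = 0`. -/
lemma featureVar_le_coverage_mul {π π' : X → A → ℝ} (hπ : ∀ x, π x ∈ stdSimplex ℝ A) {C : ℝ}
    (hC : 0 < C) (h : ∀ v, M.featureVar π' v ≤ C * M.featureVar π v) (v : Fin d → ℝ) :
    M.featureVar π' v ≤ M.coverage π π' * M.featureVar π v := by
  obtain h0 | h0 := (M.featureVar_nonneg hπ v).eq_or_lt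
  · have := h v
    rw [← h0] at this ⊢
    simpa using this
  · rw [← div_le_iff₀ h0]
    refine le_csInf ⟨C, hC, (M.posSemidef_smul_cov_sub_iff C π π').2 h⟩ fun C' hC' => ?_
    rw [div_le_iff₀ h0]
    exact (M.posSemidef_smul_cov_sub_iff C' π π').1 hC'.2 v

variable {M} {p : ℝ≥0∞} {θs : Fin d → ℝ}

lemma coverage_policy_le (htar : M.target = M.policy θs) {θ : Fin d → ℝ} {r : ℝ}
    (h : lpNorm 2 (θ - θs) ≤ r) : M.coverage (M.policy θ) M.target ≤ Real.exp (2 * r) :=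
  M.coverage_le (Real.exp_pos _) fun v => htar ▸ M.featureVar_policy_le θ θs h v

lemma localCoverage_nonneg (r : ℝ) : 0 ≤ M.localCoverage p θs r := by
  refine Real.sSup_nonneg ?_
  rintro _ ⟨θ, -, rfl⟩
  exact M.coverage_nonneg _ _

/-- The density ratio bound `exp (2 * r)` makes the supremum a genuine one and not the default value
of `sSup`. -/
lemma coverage_le_localCoverage (hp : 1 ≤ p) (hp2 : p ≤ 2) (htar : M.target = M.policy θs)
    {θ : Fin d → ℝ} {r : ℝ} (h : θ ∈ lpBall p θs r) :
    M.coverage (M.policy θ) M.target ≤ M.localCoverage p θs r := by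
  refine le_csSup ⟨Real.exp (2 * r), ?_⟩ ⟨θ, h, rfl⟩
  rintro _ ⟨θ', h', rfl⟩
  exact coverage_policy_le htar ((lpNorm_two_le hp hp2 _).trans h')

lemma localCoverage_le_exp (hp : 1 ≤ p) (hp2 : p ≤ 2) (htar : M.target = M.policy θs) (r : ℝ) :
    M.localCoverage p θs r ≤ Real.exp (2 * r) := by
  refine Real.sSup_le ?_ (Real.exp_pos _).le
  rintro _ ⟨θ', h', rfl⟩
  exact coverage_policy_le htar ((lpNorm_two_le hp hp2 _).trans h')

lemma featureVar_target_le (hp : 1 ≤ p) (hp2 : p ≤ 2) (htar : M.target = M.policy θs)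
    (θ v : Fin d → ℝ) :
    M.featureVar M.target v ≤
      M.localCoverage p θs (lpNorm p (θ - θs)) * M.featureVar (M.policy θ) v := by
  refine (M.featureVar_le_coverage_mul (M.policy_mem θ) (Real.exp_pos (2 * lpNorm 2 (θ - θs)))
    (fun v => htar ▸ M.featureVar_policy_le θ θs le_rfl v) v).trans ?_
  exact mul_le_mul_of_nonneg_right (coverage_le_localCoverage hp hp2 htar (le_refl (lpNorm p _)))
    (M.featureVar_nonneg (M.policy_mem θ) v)

lemma mul_sq_le_featureVar {lam : ℝ} {π : X → A → ℝ}
    (h : (M.cov π - lam • (1 : Matrix (Fin d) (Fin d) ℝ)).PosSemidef) (v : Fin d → ℝ) :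
    lam * lpNorm 2 v ^ 2 ≤ M.featureVar π v := by
  have h1 := (Matrix.posSemidef_iff_dotProduct_mulVec.1 h).2 v
  rw [star_trivial, Matrix.sub_mulVec, Matrix.smul_mulVec, Matrix.one_mulVec, dotProduct_sub,
    dotProduct_smul, dotProduct_cov_mulVec, smul_eq_mul] at h1
  rw [lpNorm_two_sq]
  simpa [dotProduct, sq] using h1

lemma exists_lpNorm_two_eq_one (hd : d ≠ 0) : ∃ v : Fin d → ℝ, lpNorm 2 v = 1 := by
  refine ⟨Pi.single ⟨0, Nat.pos_of_ne_zero hd⟩ 1, ?_⟩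
  have h : lpNorm 2 (Pi.single ⟨0, Nat.pos_of_ne_zero hd⟩ 1 : Fin d → ℝ) ^ 2 = 1 := by
    rw [lpNorm_two_sq, Fintype.sum_eq_single ⟨0, Nat.pos_of_ne_zero hd⟩]
    · simp
    · intro i hi
      simp [hi]
  exact (pow_eq_one_iff_of_nonneg (norm_nonneg _) two_ne_zero).1 h

lemma le_one_of_posSemidef {lam : ℝ} (hd : d ≠ 0) {π : X → A → ℝ}
    (hπ : ∀ x, π x ∈ stdSimplex ℝ A)
    (h : (M.cov π - lam • (1 : Matrix (Fin d) (Fin d) ℝ)).PosSemidef) : lam ≤ 1 := by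
  obtain ⟨v, hv⟩ := exists_lpNorm_two_eq_one hd
  have h1 := mul_sq_le_featureVar h v
  have h2 := M.featureVar_le_sq hπ v
  rw [hv] at h1 h2
  linarith

/-- The target covers itself with constant at least one, as its variance is nonzero. In dimension 0
this fails: every `C > 0` is admissible and the coverage is 0. -/
lemma one_le_localCoverage (hp : 1 ≤ p) (hp2 : p ≤ 2) (htar : M.target = M.policy θs)
    (hd : d ≠ 0) {lam : ℝ} (hlam : 0 < lam)
    (h : (M.cov M.target - lam • (1 : Matrix (Fin d) (Fin d) ℝ)).PosSemidef) {r : ℝ}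
    (hr : 0 ≤ r) : 1 ≤ M.localCoverage p θs r := by
  obtain ⟨v, hv⟩ := exists_lpNorm_two_eq_one hd
  have h1 := mul_sq_le_featureVar h v
  have hpos : 0 < M.featureVar M.target v := by
    rw [hv] at h1
    linarith
  have h2 : θs ∈ lpBall p θs r := by
    simpa [lpBall, lpNorm_zero hp] using hr
  refine le_trans ?_ (coverage_le_localCoverage hp hp2 htar h2)
  have h3 := M.featureVar_le_coverage_mul (M.policy_mem θs) (π' := M.target) one_pos
    (fun v => by rw [htar, one_mul]) v
  rw [htar] at hpos h3 ⊢
  exact (le_mul_iff_one_le_left hpos).1 h3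

/-- The ratio of normalizers is an exponential moment under `M.policy θ`, which reduces KL to
`log_sum_mul_exp_sub_le`. -/
lemma log_policy_div (θ θ' : Fin d → ℝ) {x : X} {a : A} (ha : M.policy θ x a ≠ 0) :
    Real.log (M.policy θ x a / M.policy θ' x a) =
      Real.log (∑ b, M.policy θ x b * Real.exp ((θ' - θ) ⬝ᵥ M.feature x b)) -
        (θ' - θ) ⬝ᵥ M.feature x a := by
  have hZ := M.normalizer_pos (fun x a => θ ⬝ᵥ M.feature x a) x
  have hZ' := M.normalizer_pos (fun x a => θ' ⬝ᵥ M.feature x a) x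
  have hb : M.base x a ≠ 0 := by
    rintro hb
    exact ha (by simp [policy, tilt, hb])
  have e : ∑ b, M.policy θ x b * Real.exp ((θ' - θ) ⬝ᵥ M.feature x b) =
      (∑ b, M.base x b * Real.exp (θ' ⬝ᵥ M.feature x b)) /
        ∑ b, M.base x b * Real.exp (θ ⬝ᵥ M.feature x b) := by
    rw [sum_div]
    refine sum_congr rfl fun b _ => ?_
    rw [policy, tilt, div_mul_eq_mul_div, mul_assoc, ← Real.exp_add, sub_dotProduct,
      add_sub_cancel]
  rw [e, ← Real.log_exp ((θ' - θ) ⬝ᵥ M.feature x a), ← Real.log_div (by positivity) (by positivity)]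
  congr 1
  simp only [policy, tilt]
  rw [sub_dotProduct, Real.exp_sub]
  field_simp

lemma kl_policy_le (θ θ' : Fin d → ℝ) :
    M.kl (M.policy θ) (M.policy θ') ≤ lpNorm 2 (θ - θ') ^ 2 := by
  calc M.kl (M.policy θ) (M.policy θ') ≤ ∑ x, M.prompt x * lpNorm 2 (θ' - θ) ^ 2 := by
        refine sum_le_sum fun x _ => mul_le_mul_of_nonneg_left ?_ (M.prompt_mem.1 x)
        refine le_trans (le_of_eq ?_) (log_sum_mul_exp_sub_le (M.policy_mem θ x)
          (fun a => M.abs_dotProduct_feature_le (θ' - θ) x a))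
        set ℓ := Real.log (∑ b, M.policy θ x b * Real.exp ((θ' - θ) ⬝ᵥ M.feature x b)) with hℓ
        have e (a : A) : M.policy θ x a * Real.log (M.policy θ x a / M.policy θ' x a) =
            M.policy θ x a * ℓ - M.policy θ x a * ((θ' - θ) ⬝ᵥ M.feature x a) := by
          by_cases ha : M.policy θ x a = 0
          · simp [ha]
          · rw [log_policy_div θ θ' ha, mul_sub]
        rw [sum_congr rfl fun a _ => e a, sum_sub_distrib, ← sum_mul, (M.policy_mem θ x).2,
          one_mul]
    _ = lpNorm 2 (θ - θ') ^ 2 := by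
        rw [← sum_mul, M.prompt_mem.2, one_mul, lpNorm_two_sq, lpNorm_two_sq]
        exact sum_congr rfl fun i _ => by simp only [Pi.sub_apply]; ring

end Bandit

/-! ### Likelihood ratios and maximum likelihood for one batch. -/

namespace Bandit

variable {X : Type u} {A : Type v} [Fintype X] [Fintype A] {d : ℕ} (M : Bandit X A d)

/-- The logit of the observed preference in the linear Bradley-Terry model with parameter `θ`. -/
noncomputable def logit (θ : Fin d → ℝ) (s : Sample X A) : ℝ :=
  M.γ * (θ ⬝ᵥ M.feature s.prompt s.win - θ ⬝ᵥ M.feature s.prompt s.lose)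

lemma abs_logit_sub_le (θ θ' : Fin d → ℝ) (s : Sample X A) :
    |M.logit θ s - M.logit θ' s| ≤ 2 * (M.γ * lpNorm 2 (θ - θ')) := by
  have h1 := M.abs_dotProduct_feature_le (θ - θ') s.prompt s.win
  have h2 := M.abs_dotProduct_feature_le (θ - θ') s.prompt s.lose
  have e : M.logit θ s - M.logit θ' s = M.γ * ((θ - θ') ⬝ᵥ M.feature s.prompt s.win -
      (θ - θ') ⬝ᵥ M.feature s.prompt s.lose) := by
    simp only [logit, sub_dotProduct]; ring
  rw [e, abs_mul, abs_of_pos M.γ_pos, mul_left_comm]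
  refine mul_le_mul_of_nonneg_left ?_ M.γ_pos.le
  linarith [abs_sub ((θ - θ') ⬝ᵥ M.feature s.prompt s.win)
    ((θ - θ') ⬝ᵥ M.feature s.prompt s.lose)]

lemma abs_logit_le {θ : Fin d → ℝ} {R : ℝ} (h : lpNorm 2 θ ≤ R) (s : Sample X A) :
    |M.logit θ s| ≤ 2 * (M.γ * R) := by
  have h1 := M.abs_logit_sub_le θ 0 s
  have e : M.logit 0 s = 0 := by simp [logit]
  rw [e, sub_zero, sub_zero] at h1
  exact h1.trans (by have := M.γ_pos; gcongr)

variable {M} {θs : Fin d → ℝ}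

/-- Equal tilts have exponents that differ, on the support of the base policy, by a constant
depending on the prompt only. -/
lemma reward_sub_eq (htar : M.target = M.policy θs) {x : X} {a b : A}
    (ha : M.base x a ≠ 0) (hb : M.base x b ≠ 0) :
    M.reward x a - M.reward x b =
      M.γ * (θs ⬝ᵥ M.feature x a - θs ⬝ᵥ M.feature x b) := by
  have hZ := M.normalizer_pos (fun x a => M.reward x a / M.γ) x
  have hZ' := M.normalizer_pos (fun x a => θs ⬝ᵥ M.feature x a) x
  have key (c : A) (hc : M.base x c ≠ 0) : M.reward x c / M.γ - θs ⬝ᵥ M.feature x c =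
      Real.log (∑ b, M.base x b * Real.exp (M.reward x b / M.γ)) -
        Real.log (∑ b, M.base x b * Real.exp (θs ⬝ᵥ M.feature x b)) := by
    have h := congrFun (congrFun htar x) c
    simp only [target, policy, tilt] at h
    rw [div_eq_div_iff hZ.ne' hZ'.ne', mul_assoc, mul_assoc] at h
    have h' := congrArg Real.log (mul_left_cancel₀ hc h)
    rw [Real.log_mul (Real.exp_pos _).ne' hZ'.ne', Real.log_mul (Real.exp_pos _).ne' hZ.ne',
      Real.log_exp, Real.log_exp] at h'
    linarith
  have h := (key a ha).trans (key b hb).symm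
  have hγ := M.γ_pos
  have h2 : (M.reward x a - M.reward x b) / M.γ =
      θs ⬝ᵥ M.feature x a - θs ⬝ᵥ M.feature x b := by
    rw [sub_div]; linarith
  rw [← h2, mul_div_cancel₀ _ hγ.ne']

lemma base_ne_zero_of_policy_ne_zero {θ : Fin d → ℝ} {x : X} {a : A}
    (h : M.policy θ x a ≠ 0) : M.base x a ≠ 0 := by
  rintro hb
  exact h (by simp [policy, tilt, hb])

lemma sampleProb_policy (htar : M.target = M.policy θs) (θ : Fin d → ℝ) (s : Sample X A) :
    M.sampleProb (M.policy θ) s =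
      M.prompt s.1 * M.policy θ s.1 s.2.1 * M.policy θ s.1 s.2.2.1 *
        Real.sigmoid (M.logit θs s) := by
  obtain ⟨x, a, b, y⟩ := s
  by_cases ha : M.policy θ x a = 0
  · simp [sampleProb, ha]
  by_cases hb : M.policy θ x b = 0
  · simp [sampleProb, hb]
  have hr := reward_sub_eq htar (base_ne_zero_of_policy_ne_zero ha)
    (base_ne_zero_of_policy_ne_zero hb)
  simp only [sampleProb, prefProb, hr]
  congr 1
  cases y
  · simp only [Bool.false_eq_true, if_false, ← Real.sigmoid_neg, logit, Sample.prompt, Sample.win,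
      Sample.lose]
    congr 1
    ring
  · simp [logit, Sample.prompt, Sample.win, Sample.lose]

lemma sampleProb_nonneg (htar : M.target = M.policy θs) (θ : Fin d → ℝ) (s : Sample X A) :
    0 ≤ M.sampleProb (M.policy θ) s := by
  rw [sampleProb_policy htar]
  exact mul_nonneg (mul_nonneg (mul_nonneg (M.prompt_mem.1 _) ((M.policy_mem θ _).1 _))
    ((M.policy_mem θ _).1 _)) (Real.sigmoid_nonneg _)

lemma sum_prompt_mul_sum_sum (θ : Fin d → ℝ) :
    ∑ x, ∑ a, ∑ b, M.prompt x * M.policy θ x a * M.policy θ x b = 1 := by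
  simp only [mul_assoc, ← mul_sum, (M.policy_mem θ _).2, mul_one, M.prompt_mem.2]

lemma sum_sampleProb (θ : Fin d → ℝ) : ∑ s, M.sampleProb (M.policy θ) s = 1 := by
  rw [← sum_prompt_mul_sum_sum (M := M) θ]
  simp only [Fintype.sum_prod_type, Fintype.sum_bool, sampleProb, if_true, Bool.false_eq_true,
    if_false]
  refine sum_congr rfl fun x _ => sum_congr rfl fun a _ => sum_congr rfl fun b _ => by ring

/-- The Hellinger affinity of the preference models with parameters `θ` and `θs`. -/
lemma sum_sampleProb_mul_sqrt_le (htar : M.target = M.policy θs) {R : ℝ}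
    (hs : lpNorm 2 θs ≤ R) (θ₀ : Fin d → ℝ) {θ : Fin d → ℝ} (h : lpNorm 2 θ ≤ R) :
    ∑ s, M.sampleProb (M.policy θ₀) s *
        √(Real.sigmoid (M.logit θ s) / Real.sigmoid (M.logit θs s)) ≤
      Real.exp (-(M.γ ^ 2 * M.featureVar (M.policy θ₀) (θ - θs) /
        (16 * Real.exp (2 * (M.γ * R))))) := by
  set E := Real.exp (2 * (M.γ * R)) with hE
  have hE0 : 0 < E := Real.exp_pos _
  have hmul (s : Sample X A) : Real.sigmoid (M.logit θs s) *
      √(Real.sigmoid (M.logit θ s) / Real.sigmoid (M.logit θs s)) =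
        √(Real.sigmoid (M.logit θ s) * Real.sigmoid (M.logit θs s)) := by
    have h0 := Real.sigmoid_pos (M.logit θs s)
    rw [← Real.sqrt_sq h0.le, ← Real.sqrt_mul (sq_nonneg _), Real.sqrt_sq h0.le]
    congr 1
    field_simp
  have hneg (θ : Fin d → ℝ) (x : X) (a b : A) :
      M.logit θ (x, a, b, false) = -M.logit θ (x, a, b, true) := by
    simp only [logit, Sample.prompt, Sample.win, Sample.lose, if_true, Bool.false_eq_true,
      if_false]
    ring
  -- For independent `a`, `b` the mean squared difference is twice the variance, whence 16 in place
  -- of 32.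
  have hsum : ∑ x, ∑ a, ∑ b, M.prompt x * M.policy θ₀ x a * M.policy θ₀ x b *
      ((M.logit θ (x, a, b, true) - M.logit θs (x, a, b, true)) ^ 2 / (32 * E)) =
        M.γ ^ 2 * M.featureVar (M.policy θ₀) (θ - θs) / (16 * E) := by
    have e (x : X) : ∑ a, ∑ b, M.prompt x * M.policy θ₀ x a * M.policy θ₀ x b *
        ((M.logit θ (x, a, b, true) - M.logit θs (x, a, b, true)) ^ 2 / (32 * E)) =
        M.prompt x * (M.γ ^ 2 / (32 * E)) * ∑ a, ∑ b, M.policy θ₀ x a * M.policy θ₀ x b *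
          ((θ - θs) ⬝ᵥ M.feature x a - (θ - θs) ⬝ᵥ M.feature x b) ^ 2 := by
      simp only [mul_sum]
      refine sum_congr rfl fun a _ => sum_congr rfl fun b _ => ?_
      simp only [logit, Sample.prompt, Sample.win, Sample.lose, if_true, sub_dotProduct]
      ring
    simp only [e, sum_sum_mul_sub_sq (M.policy_mem θ₀ _) fun a => (θ - θs) ⬝ᵥ M.feature _ a]
    rw [featureVar, mul_sum, sum_div]
    refine sum_congr rfl fun x _ => ?_
    field_simp
    ring
  calc ∑ s, M.sampleProb (M.policy θ₀) s *
        √(Real.sigmoid (M.logit θ s) / Real.sigmoid (M.logit θs s))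
      = ∑ x, ∑ a, ∑ b, M.prompt x * M.policy θ₀ x a * M.policy θ₀ x b *
          (√(Real.sigmoid (M.logit θ (x, a, b, true)) * Real.sigmoid (M.logit θs (x, a, b, true)))
            + √(Real.sigmoid (-M.logit θ (x, a, b, true)) *
              Real.sigmoid (-M.logit θs (x, a, b, true)))) := by
        simp only [sampleProb_policy htar, mul_assoc, hmul]
        simp only [Fintype.sum_prod_type, Fintype.sum_bool, hneg, mul_add]
    _ ≤ ∑ x, ∑ a, ∑ b, M.prompt x * M.policy θ₀ x a * M.policy θ₀ x b *
          (1 - (M.logit θ (x, a, b, true) - M.logit θs (x, a, b, true)) ^ 2 / (32 * E)) := by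
        refine sum_le_sum fun x _ => sum_le_sum fun a _ => sum_le_sum fun b _ => ?_
        refine mul_le_mul_of_nonneg_left ?_ (mul_nonneg (mul_nonneg (M.prompt_mem.1 _)
          ((M.policy_mem θ₀ _).1 _)) ((M.policy_mem θ₀ _).1 _))
        exact sqrt_sigmoid_mul_add_le (M.abs_logit_le h _) (M.abs_logit_le hs _)
    _ = 1 - M.γ ^ 2 * M.featureVar (M.policy θ₀) (θ - θs) / (16 * E) := by
        simp only [mul_sub (M.prompt _ * _ * _), mul_one, sum_sub_distrib, hsum,
          sum_prompt_mul_sum_sum]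
    _ ≤ _ := by
        linarith [Real.add_one_le_exp (-(M.γ ^ 2 * M.featureVar (M.policy θ₀) (θ - θs) / (16 * E)))]

lemma dataProb_nonneg (htar : M.target = M.policy θs) (θ : Fin d → ℝ) {n : ℕ}
    (D : Fin n → Sample X A) : 0 ≤ M.dataProb (M.policy θ) D :=
  prod_nonneg fun _ _ => sampleProb_nonneg htar θ _

lemma sum_dataProb_mul_prod (π : X → A → ℝ) (n : ℕ) (g : Sample X A → ℝ) :
    ∑ D : Fin n → Sample X A, M.dataProb π D * ∏ i, g (D i) =
      (∑ s, M.sampleProb π s * g s) ^ n := by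
  simp only [dataProb, ← prod_mul_distrib]
  have h := (Finset.prod_univ_sum (fun _ : Fin n => (univ : Finset (Sample X A)))
    (fun _ s => M.sampleProb π s * g s)).symm
  rw [Fintype.piFinset_univ] at h
  rw [h, prod_const, card_univ, Fintype.card_fin]

lemma sum_dataProb (θ : Fin d → ℝ) (n : ℕ) :
    ∑ D : Fin n → Sample X A, M.dataProb (M.policy θ) D = 1 := by
  have h := sum_dataProb_mul_prod (M := M) (M.policy θ) n (fun _ => 1)
  simpa [sum_sampleProb] using h

/-- The data sets on which some parameter in `T` has an atypically large likelihood. -/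
def IsAtypical (M : Bandit X A d) (θs : Fin d → ℝ) (R ε : ℝ) (T : Finset (Fin d → ℝ))
    (θ₀ : Fin d → ℝ) {n : ℕ} (D : Fin n → Sample X A) : Prop :=
  ∃ t ∈ T, T.card / ε * Real.exp (-(M.γ ^ 2 * M.featureVar (M.policy θ₀) (t - θs) /
      (16 * Real.exp (2 * (M.γ * R))))) ^ n <
    ∏ i, √(Real.sigmoid (M.logit t (D i)) / Real.sigmoid (M.logit θs (D i)))

open Classical in
-- Markov's inequality gives each `t ∈ T` failure probability at most `ε / T.card`, since the mean
-- of its product is an affinity to the power `n`.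
lemma sum_dataProb_isAtypical_le (htar : M.target = M.policy θs) {R ε : ℝ} (hε : 0 < ε)
    (hs : lpNorm 2 θs ≤ R) {T : Finset (Fin d → ℝ)} (hT : ∀ t ∈ T, lpNorm 2 t ≤ R)
    (θ₀ : Fin d → ℝ) (n : ℕ) :
    (∑ D : Fin n → Sample X A,
      if M.IsAtypical θs R ε T θ₀ D then M.dataProb (M.policy θ₀) D else 0) ≤ ε := by
  obtain rfl | hne := T.eq_empty_or_nonempty
  · simp [IsAtypical, hε.le]
  have hN : (0 : ℝ) < T.card := by exact_mod_cast hne.card_pos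
  set g : (Fin d → ℝ) → Sample X A → ℝ := fun t s =>
    √(Real.sigmoid (M.logit t s) / Real.sigmoid (M.logit θs s)) with hg
  set b : (Fin d → ℝ) → ℝ := fun t => Real.exp (-(M.γ ^ 2 *
    M.featureVar (M.policy θ₀) (t - θs) / (16 * Real.exp (2 * (M.γ * R))))) with hb
  have hb0 (t) : 0 < b t := Real.exp_pos _
  calc _ ≤ ∑ D : Fin n → Sample X A, ∑ t ∈ T,
        (M.dataProb (M.policy θ₀) D * ∏ i, g t (D i)) / (T.card / ε * b t ^ n) := by
        refine sum_le_sum fun D _ => ?_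
        have hD := dataProb_nonneg htar θ₀ D
        have h0 (t) : 0 ≤ (M.dataProb (M.policy θ₀) D * ∏ i, g t (D i)) /
            (T.card / ε * b t ^ n) := by
          have : 0 ≤ ∏ i, g t (D i) := prod_nonneg fun i _ => Real.sqrt_nonneg _
          have := hb0 t
          positivity
        split_ifs with h
        · obtain ⟨t, ht, hlt⟩ := h
          refine le_trans ?_ (single_le_sum (fun t _ => h0 t) ht)
          have := hb0 t
          rw [le_div_iff₀ (by positivity)]
          exact mul_le_mul_of_nonneg_left hlt.le hD
        · exact sum_nonneg fun t _ => h0 t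
    _ = ∑ t ∈ T, (∑ s, M.sampleProb (M.policy θ₀) s * g t s) ^ n / (T.card / ε * b t ^ n) := by
        rw [sum_comm]
        exact sum_congr rfl fun t _ => by rw [← sum_div, sum_dataProb_mul_prod]
    _ ≤ ∑ t ∈ T, ε / T.card := by
        refine sum_le_sum fun t ht => ?_
        have := hb0 t
        rw [div_le_iff₀ (by positivity), ← mul_assoc, div_mul_div_cancel₀ hN.ne',
          div_self hε.ne', one_mul]
        refine pow_le_pow_left₀ (sum_nonneg fun s _ => mul_nonneg (sampleProb_nonneg htar θ₀ s)
          (Real.sqrt_nonneg _)) (sum_sampleProb_mul_sqrt_le htar hs θ₀ (hT t ht)) n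
    _ = ε := by rw [sum_const, nsmul_eq_mul, mul_div_cancel₀ _ hN.ne']

lemma dpoLoss_policy {n : ℕ} {D : Fin n → Sample X A}
    (hD : ∀ i, M.base (D i).prompt (D i).win ≠ 0 ∧ M.base (D i).prompt (D i).lose ≠ 0)
    (θ : Fin d → ℝ) :
    M.dpoLoss (M.policy θ) D = -∑ i, Real.log (Real.sigmoid (M.logit θ (D i))) := by
  rw [dpoLoss, ← sum_neg_distrib]
  refine sum_congr rfl fun i _ => ?_
  have hZ := M.normalizer_pos (fun x a => θ ⬝ᵥ M.feature x a) (D i).prompt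
  obtain ⟨h1, h2⟩ := hD i
  have e : M.policy θ (D i).prompt (D i).win / M.policy θ (D i).prompt (D i).lose =
      M.base (D i).prompt (D i).win / M.base (D i).prompt (D i).lose *
        Real.exp (θ ⬝ᵥ M.feature (D i).prompt (D i).win -
          θ ⬝ᵥ M.feature (D i).prompt (D i).lose) := by
    simp only [policy, tilt, Real.exp_sub]
    field_simp
  rw [e, Real.log_mul (div_ne_zero h1 h2) (Real.exp_pos _).ne', Real.log_exp, logit]
  congr 3
  ring

lemma base_ne_zero_of_dataProb_ne_zero {θ₀ : Fin d → ℝ} {n : ℕ} {D : Fin n → Sample X A}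
    (h : M.dataProb (M.policy θ₀) D ≠ 0) (i : Fin n) :
    M.base (D i).prompt (D i).win ≠ 0 ∧ M.base (D i).prompt (D i).lose ≠ 0 := by
  have h1 : M.sampleProb (M.policy θ₀) (D i) ≠ 0 := fun h0 => h (prod_eq_zero (mem_univ i) h0)
  revert h1
  obtain ⟨x, a, b, y⟩ := D i
  intro h1
  have ha : M.base x a ≠ 0 := base_ne_zero_of_policy_ne_zero (θ := θ₀) fun h0 => h1 (by
    simp [sampleProb, h0])
  have hb : M.base x b ≠ 0 := base_ne_zero_of_policy_ne_zero (θ := θ₀) fun h0 => h1 (by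
    simp [sampleProb, h0])
  cases y <;> simp [Sample.prompt, Sample.win, Sample.lose, ha, hb]

/-- The error of a maximum likelihood estimator on a typical data set. -/
lemma featureVar_le_of_not_isAtypical {R ε ρ : ℝ} (hε : 0 < ε)
    {T : Finset (Fin d → ℝ)} {θ₀ θ t : Fin d → ℝ} {n : ℕ} {D : Fin n → Sample X A}
    {Θ : Set (Fin d → ℝ)} (hs : θs ∈ Θ)
    (hmin : IsMinOn (fun θ => M.dpoLoss (M.policy θ) D) Θ θ)
    (hD : M.dataProb (M.policy θ₀) D ≠ 0) (hT : ¬ M.IsAtypical θs R ε T θ₀ D)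
    (ht : t ∈ T) (hθt : lpNorm 2 (θ - t) ≤ ρ) :
    M.γ ^ 2 * n * M.featureVar (M.policy θ₀) (t - θs) ≤
      16 * Real.exp (2 * (M.γ * R)) * (Real.log (T.card / ε) + M.γ * ρ * n) := by
  have hγ := M.γ_pos
  have hN : (0 : ℝ) < T.card := by exact_mod_cast card_pos.2 ⟨t, ht⟩
  have hloss : 0 ≤ ∑ i, (Real.log (Real.sigmoid (M.logit θ (D i))) -
      Real.log (Real.sigmoid (M.logit θs (D i)))) := by
    have h := isMinOn_iff.1 hmin θs hs
    rw [dpoLoss_policy (base_ne_zero_of_dataProb_ne_zero hD),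
      dpoLoss_policy (base_ne_zero_of_dataProb_ne_zero hD)] at h
    rw [sum_sub_distrib]
    linarith
  -- The estimator is at least as likely as `θs`. Moving it to `t` changes each logit by at most
  -- `2γρ`, hence each square-root log-ratio by at most `γρ`.
  have hlow : -(M.γ * ρ * n) ≤
      Real.log (∏ i, √(Real.sigmoid (M.logit t (D i)) / Real.sigmoid (M.logit θs (D i)))) := by
    have hpos (i) : 0 < Real.sigmoid (M.logit t (D i)) / Real.sigmoid (M.logit θs (D i)) :=
      div_pos (Real.sigmoid_pos _) (Real.sigmoid_pos _)
    rw [Real.log_prod fun i _ => (Real.sqrt_pos.2 (hpos i)).ne']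
    have h1 (i) : (Real.log (Real.sigmoid (M.logit θ (D i))) -
        Real.log (Real.sigmoid (M.logit θs (D i)))) / 2 - M.γ * ρ ≤
        Real.log √(Real.sigmoid (M.logit t (D i)) / Real.sigmoid (M.logit θs (D i))) := by
      rw [Real.log_sqrt (hpos i).le, Real.log_div (Real.sigmoid_pos _).ne'
        (Real.sigmoid_pos _).ne']
      have h2 := Real.log_le_log (Real.sigmoid_pos _)
        (sigmoid_le_exp_mul (M.logit t (D i)) (M.logit θ (D i)))
      rw [Real.log_mul (Real.exp_pos _).ne' (Real.sigmoid_pos _).ne', Real.log_exp,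
        abs_sub_comm] at h2
      have h3 := M.abs_logit_sub_le θ t (D i)
      have h4 : M.γ * lpNorm 2 (θ - t) ≤ M.γ * ρ := by gcongr
      linarith
    have h2 := sum_le_sum (s := univ) fun i _ => h1 i
    rw [sum_sub_distrib, ← sum_div, sum_const, card_univ, Fintype.card_fin, nsmul_eq_mul] at h2
    linarith
  have hup := not_lt.1 fun hlt => hT ⟨t, ht, hlt⟩
  have hprod : 0 < ∏ i, √(Real.sigmoid (M.logit t (D i)) / Real.sigmoid (M.logit θs (D i))) :=
    prod_pos fun i _ => Real.sqrt_pos.2 (div_pos (Real.sigmoid_pos _) (Real.sigmoid_pos _))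
  have h := hlow.trans (Real.log_le_log hprod hup)
  rw [Real.log_mul (by positivity) (by positivity), Real.log_pow, Real.log_exp] at h
  have hE := Real.exp_pos (2 * (M.γ * R))
  have h5 : M.γ ^ 2 * n * M.featureVar (M.policy θ₀) (t - θs) /
      (16 * Real.exp (2 * (M.γ * R))) ≤ Real.log (T.card / ε) + M.γ * ρ * n := by
    have e : M.γ ^ 2 * n * M.featureVar (M.policy θ₀) (t - θs) / (16 * Real.exp (2 * (M.γ * R))) =
      n * (M.γ ^ 2 * M.featureVar (M.policy θ₀) (t - θs) / (16 * Real.exp (2 * (M.γ * R)))) := by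
      ring
    rw [e]
    linarith
  rw [div_le_iff₀ (by positivity)] at h5
  linarith

/-! ### The law of a full adaptive run. -/

section Runs

variable {n : ℕ} (est : (k : ℕ) → (Fin k → Fin n → Sample X A) → Fin d → ℝ)

lemma runProb_succ {K : ℕ} (h : Fin (K + 1) → Fin n → Sample X A) :
    M.runProb est h = M.runProb est (Fin.init h) *
      M.dataProb (M.policy (est K (Fin.init h))) (h (Fin.last K)) := by
  rw [runProb, Fin.prod_univ_castSucc]
  rfl

lemma sum_init_last {α : Type*} [Fintype α] {K : ℕ} (F : (Fin K → α) → α → ℝ) :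
    ∑ h : Fin (K + 1) → α, F (Fin.init h) (h (Fin.last K)) = ∑ h, ∑ D, F h D := by
  rw [← (Fin.snocEquiv fun _ : Fin (K + 1) => α).sum_comp, Fintype.sum_prod_type, sum_comm]
  simp [Fin.snocEquiv, Fin.init_snoc]

lemma runProb_nonneg (htar : M.target = M.policy θs) {K : ℕ} (h : Fin K → Fin n → Sample X A) :
    0 ≤ M.runProb est h :=
  prod_nonneg fun _ _ => dataProb_nonneg htar _ _

lemma sum_runProb (K : ℕ) : ∑ h : Fin K → Fin n → Sample X A, M.runProb est h = 1 := by
  induction K with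
  | zero => simp [runProb]
  | succ K ih =>
    simp only [runProb_succ]
    rw [sum_init_last fun h D => M.runProb est h * M.dataProb (M.policy (est K h)) D]
    simp only [← mul_sum, sum_dataProb, mul_one, ih]

open Classical in
-- Union bound by conditioning on the past: `hB` is uniform in the sampling parameter, so it applies
-- although that parameter depends on earlier batches.
lemma sum_runProb_exists_le (htar : M.target = M.policy θs) {ε : ℝ}
    (B : (Fin d → ℝ) → (Fin n → Sample X A) → Prop)
    (hB : ∀ θ, (∑ D, if B θ D then M.dataProb (M.policy θ) D else 0) ≤ ε) (K : ℕ) :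
    (∑ h : Fin K → Fin n → Sample X A,
      if ∃ k : Fin K, B (est k fun j : Fin k => h (Fin.castLE k.2.le j)) (h k)
        then M.runProb est h else 0) ≤ K * ε := by
  induction K with
  | zero => simp
  | succ K ih =>
    set G : (Fin K → Fin n → Sample X A) → Prop := fun h =>
      ∃ k : Fin K, B (est k fun j : Fin k => h (Fin.castLE k.2.le j)) (h k)
    calc _ ≤ ∑ h : Fin (K + 1) → Fin n → Sample X A,
          ((if G (Fin.init h) then M.runProb est (Fin.init h) else 0) *
            M.dataProb (M.policy (est K (Fin.init h))) (h (Fin.last K)) +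
          M.runProb est (Fin.init h) * (if B (est K (Fin.init h)) (h (Fin.last K)) then
            M.dataProb (M.policy (est K (Fin.init h))) (h (Fin.last K)) else 0)) := by
          refine sum_le_sum fun h _ => ?_
          have h1 := runProb_nonneg est htar (Fin.init h)
          have h2 := dataProb_nonneg htar (est K (Fin.init h)) (h (Fin.last K))
          rw [runProb_succ]
          split_ifs with h3 h4 h5 h5
          · have := mul_nonneg h1 h2
            linarith
          · simp
          · simp
          · obtain ⟨k, hk⟩ := h3
            revert hk
            refine Fin.lastCases (fun hk => absurd hk h5) (fun k hk => ?_) k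
            exact absurd ⟨k, hk⟩ h4
          · exact add_nonneg (mul_nonneg h1 h2) (mul_nonneg h1 h2)
          · positivity
          · positivity
          · simp
      _ ≤ (K + 1 : ℕ) * ε := by
          rw [sum_init_last fun h D => (if G h then M.runProb est h else 0) *
            M.dataProb (M.policy (est K h)) D + M.runProb est h *
            (if B (est K h) D then M.dataProb (M.policy (est K h)) D else 0)]
          simp only [sum_add_distrib, ← mul_sum, sum_dataProb, mul_one]
          have h1 : ∑ h : Fin K → Fin n → Sample X A, M.runProb est h *
              (∑ D, if B (est K h) D then M.dataProb (M.policy (est K h)) D else 0) ≤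
              ∑ h : Fin K → Fin n → Sample X A, M.runProb est h * ε :=
            sum_le_sum fun h _ => mul_le_mul_of_nonneg_left (hB _) (runProb_nonneg est htar h)
          rw [← sum_mul, sum_runProb, one_mul] at h1
          push_cast
          linarith

end Runs

end Bandit

/-! ### Constants, the error recursion and the confidence budget. -/

section Numerics

/-- The statistical error of one round in terms of the rate. -/
lemma log_card_div_le {c₀ g δ b N E : ℝ} {d n K : ℕ} (hc₀ : 0 < c₀) (hb0 : 0 ≤ b)
    (hb : -Real.log c₀ ≤ b) (hg : c₀ ≤ g) (hgn : 1 ≤ g * n) (hK : 1 ≤ K) (hδ : 0 < δ)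
    (hδ1 : δ < 1) (hd : 1 ≤ d) (hN0 : 0 < N) (hN : N ≤ (2 * (g * n) * √d + 2) ^ d)
    (hdn : (d : ℝ) ≤ n) (hlog : 15 * b + 48 ≤ Real.log n) (hE : 1 ≤ E) :
    1.01 * (16 * E * (Real.log (N / (δ / (K * (n * (n + 1))))) + 1)) + 101 / n ≤
      52 * E * d * Real.log (9 * g * K * n / δ) := by
  have hd1 : (1 : ℝ) ≤ d := by exact_mod_cast hd
  have hK1 : (1 : ℝ) ≤ K := by exact_mod_cast hK
  have hn1 : (1 : ℝ) ≤ n := hd1.trans hdn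
  have hg0 : 0 < g := hc₀.trans_le hg
  set G := Real.log (g * n) with hG
  set J := Real.log (K / δ) with hJ
  set ℓ := Real.log n with hℓ
  have hG0 : 0 ≤ G := Real.log_nonneg hgn
  have hJ0 : 0 ≤ J := Real.log_nonneg (by rw [le_div_iff₀ hδ]; linarith)
  have hℓG : ℓ ≤ G + b := by
    have h1 := Real.log_le_log hc₀ hg
    rw [hG, Real.log_mul (by positivity) (by positivity)]
    linarith
  have hL : G + J ≤ Real.log (9 * g * K * n / δ) := by
    have e : 9 * g * K * n / δ = 9 * ((g * n) * (K / δ)) := by ring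
    have h9 : 0 ≤ Real.log 9 := Real.log_nonneg (by norm_num)
    rw [e, Real.log_mul (by norm_num) (by positivity), Real.log_mul (by positivity) (by positivity)]
    linarith
  set L := Real.log (9 * g * K * n / δ) with hLdef
  have hlogd0 : 0 ≤ Real.log d := Real.log_nonneg hd1
  have hlogd : Real.log d ≤ ℓ := Real.log_le_log (by linarith) hdn
  -- The `√d` in the net size is absorbed by `log n`. The factor `d - 1`, not `d`, keeps the total
  -- coefficient of `G` at `2d + 1 ≤ 3d`, even for `d = 1`.
  have hdlog : d * Real.log d / 2 ≤ (d - 1) * ℓ := by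
    obtain rfl | h2 : d = 1 ∨ 2 ≤ d := by omega
    · simp
    · have h2' : (2 : ℝ) ≤ d := by exact_mod_cast h2
      calc d * Real.log d / 2 ≤ (d - 1) * Real.log d := by nlinarith
        _ ≤ (d - 1) * ℓ := by gcongr
  have hl2 : Real.log 2 ≤ 0.7 := by linarith [Real.log_two_lt_d9]
  have hl4 : Real.log 4 ≤ 1.4 := by
    have : (4 : ℝ) = 2 ^ 2 := by norm_num
    rw [this, Real.log_pow]
    push_cast
    linarith
  have hlogN : Real.log N ≤ d * (1.4 + G) + (d - 1) * (G + b) := by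
    have hsd : 1 ≤ √(d : ℝ) := Real.one_le_sqrt.2 hd1
    have h1 : N ≤ (4 * ((g * n) * √d)) ^ d := by
      refine hN.trans (pow_le_pow_left₀ (by positivity) ?_ d)
      nlinarith [one_le_mul_of_one_le_of_one_le hgn hsd]
    have h2 := Real.log_le_log hN0 h1
    rw [Real.log_pow, Real.log_mul (by norm_num) (by positivity),
      Real.log_mul (by positivity) (by positivity), Real.log_sqrt (by positivity)] at h2
    have h3 : (d : ℝ) * (Real.log 4 + (G + Real.log d / 2)) ≤
        d * (1.4 + G) + d * Real.log d / 2 := by nlinarith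
    have h4 : ((d : ℝ) - 1) * ℓ ≤ (d - 1) * (G + b) := by gcongr
    linarith
  have hlogδ : Real.log (N / (δ / (K * (n * (n + 1))))) ≤ Real.log N + J + 0.7 + 2 * (G + b) := by
    have e : N / (δ / (K * (n * (n + 1)))) = N * ((K / δ) * (n * (n + 1))) := by
      field_simp
    have h1 : Real.log ((n : ℝ) * (n + 1)) ≤ 0.7 + 2 * ℓ := by
      have h2 : (n : ℝ) * (n + 1) ≤ 2 * n ^ 2 := by nlinarith
      have h3 := Real.log_le_log (by positivity) h2
      rw [Real.log_mul two_ne_zero (show (n : ℝ) ^ 2 ≠ 0 by positivity), Real.log_pow] at h3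
      push_cast at h3
      linarith
    rw [e, Real.log_mul hN0.ne' (by positivity), Real.log_mul (by positivity) (by positivity)]
    linarith
  have hmain : Real.log (N / (δ / (K * (n * (n + 1))))) + 1 ≤ 3 * d * (L + b) + 3.1 * d := by
    have hle (y : ℝ) (hy : 0 ≤ y) : y ≤ d * y := le_mul_of_one_le_left hy hd1
    have h1 : (d : ℝ) * (G + J) ≤ d * L := by gcongr
    have h2 : (0 : ℝ) ≤ d * J := by positivity
    linarith [hle G hG0, hle J hJ0, hle b hb0]
  have h101 : (101 : ℝ) / n ≤ 101 * (E * d) := by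
    calc (101 : ℝ) / n ≤ 101 := div_le_self (by norm_num) hn1
      _ ≤ _ := by nlinarith [one_le_mul_of_one_le_of_one_le hE hd1]
  have hEd : 0 < E * d := by positivity
  -- The gap `52 - 48.48 = 3.52` must pay for `48.48 b + 151.096`; it does, since `L ≥ log n - b ≥
  -- 14 b + 48`.
  calc _ ≤ 1.01 * (16 * E * (3 * d * (L + b) + 3.1 * d)) + 101 * (E * d) := by gcongr
    _ = E * d * (48.48 * L + 48.48 * b + 151.096) := by ring
    _ ≤ E * d * (52 * L) := by
        refine mul_le_mul_of_nonneg_left ?_ hEd.le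
        linarith
    _ = _ := by ring

/-- The error recursion of on-policy DPO. -/
lemma sq_le_max_of_recursion {C : ℝ → ℝ} {r : ℕ → ℝ} {c c₀ κ γ R η ξ : ℝ} {K : ℕ}
    (hc : 0 < c) (hc₀ : 0 < c₀) (hcκ : c * κ ≤ c₀ ^ 2) (hc16 : 16 * c ≤ c₀ ^ 2) (hκ : 1 ≤ κ)
    (hγ : 0 < γ) (hR : 0 < R) (hη : 0 < η) (hη1 : η < 1) (hξ0 : 0 ≤ ξ) (hγR : c₀ / γ ≤ R)
    (hC0 : ∀ r, 0 ≤ C r) (hCexp : ∀ r, C r ≤ Real.exp (2 * r)) (hCR : 1 ≤ C R)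
    (hξ : ξ ≤ c / C R)
    (hgrowth : ConvexOn ℝ (Set.Icc 0 R) (fun r => √(C r)) ∨
      ({r | r ∈ Set.Ioc 0 R ∧ C r / r ^ 2 ≤ κ * (C R / R ^ 2)}.OrdConnected ∧
        ∃ r ∈ {r | r ∈ Set.Ioc 0 R ∧ C r / r ^ 2 ≤ κ * (C R / R ^ 2)}, r ≤ 1))
    (hr0 : ∀ k, 0 ≤ r k) (hrR : r 0 ≤ R)
    (hstep : ∀ k < K, r (k + 1) ^ 2 ≤ η ^ 2 * ξ / γ ^ 2 * C (r k)) :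
    r K ^ 2 ≤ max (Real.exp 1 ^ 2 / γ ^ 2 * ξ) (R ^ 2 * η ^ (2 * K)) := by
  set S := {r | r ∈ Set.Ioc 0 R ∧ C r / r ^ 2 ≤ κ * (C R / R ^ 2)} with hS
  set m : ℕ → ℝ := fun k => max (Real.exp 1 ^ 2 / γ ^ 2 * ξ) (R ^ 2 * η ^ (2 * k)) with hm
  have hcR : c₀ ≤ R * γ := (div_le_iff₀ hγ).1 hγR
  have hCR0 : 0 < C R := zero_lt_one.trans_le hCR
  have hξC : ξ * C R ≤ c := (le_div_iff₀ hCR0).1 hξ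
  have hξc : ξ ≤ c := by nlinarith
  have hsq : c₀ ^ 2 ≤ R ^ 2 * γ ^ 2 := by
    rw [← mul_pow]
    exact pow_le_pow_left₀ hc₀.le hcR 2
  have he2 : 2 ≤ Real.exp 1 := by linarith [Real.add_one_le_exp 1]
  have he3 : Real.exp 1 ≤ 3 := by linarith [Real.exp_one_lt_d9]
  have he9 : Real.exp 1 ^ 2 * ξ ≤ 9 * ξ :=
    mul_le_mul_of_nonneg_right (by nlinarith) hξ0
  have hm0 (k) : 0 ≤ m k := le_max_of_le_right (by positivity)
  have hmR (k) : m k ≤ R ^ 2 := by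
    refine max_le ?_ ?_
    -- The floor lies below `R²`: `e² ξ ≤ 9 ξ ≤ 16 c ≤ c₀² ≤ R² γ²`. Hence the iterates never leave
    -- `[0, R]`.
    · rw [div_mul_eq_mul_div, div_le_iff₀ (by positivity)]
      linarith
    · exact mul_le_of_le_one_right (by positivity) (pow_le_one₀ hη.le hη1.le)
  have hmsucc (k) : η ^ 2 * m k ≤ m (k + 1) := by
    rw [hm]
    simp only
    rw [mul_max_of_nonneg _ _ (by positivity)]
    refine max_le_max ?_ (le_of_eq (by ring))
    exact mul_le_of_le_one_left (by positivity) (pow_le_one₀ hη.le hη1.le)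
  have hRS : R ∈ S := ⟨⟨hR, le_rfl⟩, le_mul_of_one_le_left (by positivity) hκ⟩
  have key (k : ℕ) (hk : k ≤ K) : r k ^ 2 ≤ m k := by
    induction k with
    | zero => exact le_max_of_le_right (by simpa using pow_le_pow_left₀ (hr0 0) hrR 2)
    | succ k ih =>
      have ih := ih (by omega)
      have hrk : r k ≤ R := by
        have := ih.trans (hmR k)
        exact (sq_le_sq₀ (hr0 k) hR.le).1 this
      have hs := hstep k (by omega)
      have hrk0 := hr0 k
      rcases hgrowth with hconv | ⟨hord, r₀, hr₀, hr₀1⟩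
      · refine le_trans ?_ (hmsucc k)
        -- The chord bound on `[0, R]`, with `C 0 ≤ 1` from the exponential bound. Below, the
        -- constant term costs at most `w / 2` by the floor and the linear term at most `w / 4`.
        have hle : √(C (r k)) ≤ 1 + r k / R * √(C R) := by
          have h3 : 0 ≤ r k / R := by positivity
          have h4 : 0 ≤ 1 - r k / R := by rw [sub_nonneg, div_le_one hR]; exact hrk
          have h1 := hconv.2 (show (0 : ℝ) ∈ Set.Icc 0 R from ⟨le_rfl, hR.le⟩)
            (show R ∈ Set.Icc 0 R from ⟨hR.le, le_rfl⟩) h4 h3 (by ring)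
          have e : (1 - r k / R) • (0 : ℝ) + (r k / R) • R = r k := by
            simp [hR.ne']
          rw [e] at h1
          refine h1.trans ?_
          have h2 : √(C 0) ≤ 1 := by
            rw [Real.sqrt_le_one]
            simpa using hCexp 0
          simp only [smul_eq_mul]
          nlinarith [Real.sqrt_nonneg (C 0)]
        set s := √ξ / γ with hsdef
        have hs0 : 0 ≤ s := by positivity
        have hs2 : s ^ 2 = ξ / γ ^ 2 := by rw [hsdef, div_pow, Real.sq_sqrt hξ0]
        have hsC : s * √(C R) ≤ R / 4 := by
          refine (sq_le_sq₀ (by positivity) (by positivity)).1 ?_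
          rw [mul_pow, hs2, Real.sq_sqrt hCR0.le, div_mul_eq_mul_div, div_le_iff₀ (by positivity)]
          nlinarith
        set w := √(m k) with hw
        have hw0 : 0 ≤ w := Real.sqrt_nonneg _
        have hww : w ^ 2 = m k := Real.sq_sqrt (hm0 k)
        have hrw : r k ≤ w := Real.le_sqrt_of_sq_le ih
        have hsw : 2 * s ≤ w := by
          refine Real.le_sqrt_of_sq_le (le_max_of_le_left ?_)
          have : Real.exp 1 ^ 2 / γ ^ 2 * ξ = Real.exp 1 ^ 2 * s ^ 2 := by rw [hs2]; ring
          rw [this, mul_pow]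
          gcongr
        have hsum : s * √(C (r k)) ≤ w := by
          calc s * √(C (r k)) ≤ s * (1 + r k / R * √(C R)) := by gcongr
            _ = s + r k / R * (s * √(C R)) := by ring
            _ ≤ s + r k / R * (R / 4) := by gcongr
            _ = s + r k / 4 := by field_simp
            _ ≤ w := by linarith
        calc r (k + 1) ^ 2 ≤ η ^ 2 * ξ / γ ^ 2 * C (r k) := hs
          _ = η ^ 2 * (s * √(C (r k))) ^ 2 := by
              rw [mul_pow, hs2, Real.sq_sqrt (hC0 _)]; ring
          _ ≤ η ^ 2 * m k := by
              rw [← hww]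
              gcongr
      · by_cases hkS : r k ∈ S
        · refine le_trans ?_ (hmsucc k)
          have hpos : 0 < r k := hkS.1.1
          have h1 := hkS.2
          rw [div_le_iff₀ (by positivity)] at h1
          calc r (k + 1) ^ 2 ≤ η ^ 2 * ξ / γ ^ 2 * C (r k) := hs
            _ ≤ η ^ 2 * ξ / γ ^ 2 * (κ * (C R / R ^ 2) * r k ^ 2) := by gcongr
            _ = η ^ 2 * r k ^ 2 * (ξ * C R * κ / (R ^ 2 * γ ^ 2)) := by
                field_simp
            _ ≤ η ^ 2 * r k ^ 2 * 1 := by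
                gcongr
                rw [div_le_one (by positivity)]
                nlinarith
            _ ≤ η ^ 2 * m k := by
                rw [mul_one]
                gcongr
        -- `S` contains `R` and a radius at most 1, so an interval `S` can only miss small radii
        -- (including 0). There `C ≤ e²`, and one step lands below the floor.
        · have hr1 : r k ≤ 1 := by
            by_contra! h
            exact hkS (hord.out hr₀ hRS ⟨hr₀1.trans h.le, hrk⟩)
          refine le_max_of_le_left ?_
          have h2 : C (r k) ≤ Real.exp 1 ^ 2 := by
            refine (hCexp _).trans ?_
            rw [← Real.exp_nat_mul]
            exact Real.exp_le_exp.2 (by push_cast; linarith)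
          have hCk := hC0 (r k)
          have h3 : η ^ 2 ≤ 1 := pow_le_one₀ hη.le hη1.le
          calc r (k + 1) ^ 2 ≤ η ^ 2 * ξ / γ ^ 2 * C (r k) := hs
            _ ≤ 1 * ξ / γ ^ 2 * Real.exp 1 ^ 2 := by gcongr
            _ = _ := by ring
  exact key K le_rfl

/-- Telescoping sum: the shares `δ / (n (n + 1))` of the batch sizes `n ≥ 1` add up to at most `δ`.
-/
lemma sum_range_div_mul_le (N : ℕ) {δ : ℝ} (hδ : 0 ≤ δ) :
    ∑ m ∈ range N, δ / (((m + 1 : ℕ) : ℝ) * ((m + 1 : ℕ) + 1)) ≤ δ := by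
  have h : ∑ m ∈ range N, δ / (((m + 1 : ℕ) : ℝ) * ((m + 1 : ℕ) + 1)) = δ - δ / (N + 1) := by
    induction N with
    | zero => simp
    | succ N ih =>
      rw [sum_range_succ, ih]
      push_cast
      field_simp
      ring
  rw [h]
  have : 0 ≤ δ / ((N : ℝ) + 1) := by positivity
  linarith

end Numerics

/-! ### One round in terms of the rate. -/

namespace Bandit

variable {X : Type u} {A : Type v} [Fintype X] [Fintype A] {d : ℕ} {M : Bandit X A d}
  {p : ℝ≥0∞} {θs : Fin d → ℝ}

lemma one_le_log_of_rate {R δ : ℝ} {K n : ℕ} (hδ : 0 < δ) (hδ1 : δ < 1) (hK : 1 ≤ K)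
    (hn : 1 ≤ M.γ * R * n) : 1 ≤ Real.log (9 * M.γ * R * K * n / δ) := by
  have hK1 : (1 : ℝ) ≤ K := by exact_mod_cast hK
  have h1 : 9 ≤ 9 * M.γ * R * K * n / δ := by
    rw [le_div_iff₀ hδ]
    nlinarith [one_le_mul_of_one_le_of_one_le hn hK1]
  rw [Real.le_log_iff_exp_le (by linarith)]
  linarith [Real.exp_one_lt_d9]

lemma rate_nonneg {R lam η δ : ℝ} {K n : ℕ} (hlam : 0 < lam) (hδ : 0 < δ) (hδ1 : δ < 1)
    (hK : 1 ≤ K) (hn : 1 ≤ M.γ * R * n) : 0 ≤ M.rate p R lam η δ K n := by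
  have := one_le_log_of_rate hδ hδ1 hK hn
  unfold rate
  positivity

/-- Apart from `52 d / n` the rate consists of factors at least one. A small rate thus forces `d ≤
n` and `log n` large, which absorbs lower-order terms. -/
lemma mul_dim_le_of_rate_le (hp : 1 ≤ p) (hp2 : p ≤ 2) {R lam η δ c : ℝ} {K n : ℕ}
    (hR : 0 < R) (hlam : 0 < lam) (hlam1 : lam ≤ 1) (hη : 0 < η) (hη1 : η < 1) (hδ : 0 < δ)
    (hδ1 : δ < 1) (hK : 1 ≤ K) (hn : 1 ≤ M.γ * R * n) (hd : d ≠ 0)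
    (h : M.rate p R lam η δ K n ≤ c) : 52 * d ≤ c * n := by
  have hγ := M.γ_pos
  have hn0 : (0 : ℝ) < n := by
    by_contra! h0
    have : M.γ * R * n ≤ 0 := mul_nonpos_of_nonneg_of_nonpos (by positivity) h0
    linarith
  have hL := one_le_log_of_rate hδ hδ1 hK hn
  have hd1 : (1 : ℝ) ≤ d := by exact_mod_cast Nat.one_le_iff_ne_zero.2 hd
  have hp1 := one_le_toReal hp hp2
  have hp2' := toReal_le_two hp2
  have hdp : (d : ℝ) ≤ (d : ℝ) ^ (2 / p.toReal) := by
    conv_lhs => rw [← Real.rpow_one (d : ℝ)]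
    exact Real.rpow_le_rpow_of_exponent_le hd1 (by rw [le_div_iff₀] <;> linarith)
  have hE : 1 ≤ Real.exp (4 * M.γ * R) := Real.one_le_exp (by positivity)
  have hlη : lam * η ^ 2 ≤ 1 := mul_le_one₀ hlam1 (by positivity) (pow_le_one₀ hη.le hη1.le)
  rw [← div_le_iff₀ hn0]
  refine le_trans ?_ h
  rw [rate]
  calc 52 * (d : ℝ) / n = 52 * 1 * d / (1 * n) * 1 := by ring
    _ ≤ _ := by gcongr

/-- One round of on-policy DPO on a typical batch. -/
lemma lpNorm_sq_le_of_not_isAtypical (hp : 1 ≤ p) (hp2 : p ≤ 2) (htar : M.target = M.policy θs)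
    {c₀ b R lam η δ : ℝ} {K n : ℕ} (hR : 0 < R) (hlam : 0 < lam) (hη : 0 < η) (hδ : 0 < δ)
    (hδ1 : δ < 1) (hK : 1 ≤ K) (hn : 1 ≤ M.γ * R * n) (hd : d ≠ 0)
    (hpsd : (M.cov M.target - lam • (1 : Matrix (Fin d) (Fin d) ℝ)).PosSemidef)
    (hc₀ : 0 < c₀) (hb0 : 0 ≤ b) (hb : -Real.log c₀ ≤ b) (hγR : c₀ ≤ M.γ * R)
    (hdn : (d : ℝ) ≤ n) (hlog : 15 * b + 48 ≤ Real.log n)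
    {Θ : Set (Fin d → ℝ)} (hΘ : Θ ⊆ lpBall 2 0 R) (hs : θs ∈ Θ)
    {T : Finset (Fin d → ℝ)} (hTcard : (T.card : ℝ) ≤ (2 * R * √d / (1 / (M.γ * n)) + 2) ^ d)
    (hTnet : ∀ θ, lpNorm 2 θ ≤ R → ∃ t ∈ T, lpNorm 2 (θ - t) ≤ 1 / (M.γ * n))
    {θ₀ θ : Fin d → ℝ} {D : Fin n → Sample X A}
    (hmem : θ ∈ Θ) (hmin : IsMinOn (fun θ => M.dpoLoss (M.policy θ) D) Θ θ)
    (hD : M.dataProb (M.policy θ₀) D ≠ 0)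
    (hT : ¬ M.IsAtypical θs R (δ / (K * (n * (n + 1)))) T θ₀ D) :
    lpNorm p (θ - θs) ^ 2 ≤ η ^ 2 * M.rate p R lam η δ K n / M.γ ^ 2 *
      M.localCoverage p θs (lpNorm p (θ₀ - θs)) := by
  have hγ := M.γ_pos
  have hd1 : (1 : ℝ) ≤ d := by exact_mod_cast Nat.one_le_iff_ne_zero.2 hd
  have hn1 : (1 : ℝ) ≤ n := hd1.trans hdn
  have hK1 : (1 : ℝ) ≤ K := by exact_mod_cast hK
  set L := Real.log (9 * M.γ * R * K * n / δ) with hL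
  have hL1 : 1 ≤ L := one_le_log_of_rate hδ hδ1 hK hn
  have hball : lpNorm 2 θ ≤ R := by simpa [lpBall] using hΘ hmem
  obtain ⟨t, ht, hθt⟩ := hTnet θ hball
  have hvar := featureVar_le_of_not_isAtypical (by positivity) hs hmin hD hT ht hθt
  -- With mesh `1/(γn)`, discretization costs only 1 in the exponent of the whole batch.
  have hone : M.γ * (1 / (M.γ * n)) * n = 1 := by field_simp
  rw [hone] at hvar
  have hV : M.γ ^ 2 * n * M.featureVar (M.policy θ₀) (θ - θs) ≤
      52 * Real.exp (4 * M.γ * R) * d * L := by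
    have h1 := M.featureVar_add_le (M.policy_mem θ₀) (t - θs) (θ - t)
    rw [show t - θs + (θ - t) = θ - θs by abel] at h1
    have h2 : M.featureVar (M.policy θ₀) (θ - t) ≤ (1 / (M.γ * n)) ^ 2 :=
      (M.featureVar_le_sq (M.policy_mem θ₀) _).trans
        (pow_le_pow_left₀ (norm_nonneg _) hθt 2)
    have h3 : M.γ ^ 2 * n * (101 * (1 / (M.γ * n)) ^ 2) = 101 / n := by field_simp
    have hcard : (T.card : ℝ) ≤ (2 * (M.γ * R * n) * √d + 2) ^ d := by
      convert hTcard using 3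
      field_simp
    have h4 := log_card_div_le hc₀ hb0 hb hγR hn hK hδ hδ1 (Nat.one_le_iff_ne_zero.2 hd)
      (by exact_mod_cast card_pos.2 ⟨t, ht⟩) hcard hdn hlog
      (Real.one_le_exp (x := 2 * (M.γ * R)) (by positivity))
    calc M.γ ^ 2 * n * M.featureVar (M.policy θ₀) (θ - θs)
        ≤ M.γ ^ 2 * n * (1.01 * M.featureVar (M.policy θ₀) (t - θs) +
          101 * (1 / (M.γ * n)) ^ 2) := by gcongr; linarith
      _ = 1.01 * (M.γ ^ 2 * n * M.featureVar (M.policy θ₀) (t - θs)) + 101 / n := by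
          rw [← h3]; ring
      _ ≤ _ := by
          refine (add_le_add_left (mul_le_mul_of_nonneg_left hvar (by norm_num)) _).trans
            (h4.trans ?_)
          rw [← mul_assoc 9 M.γ R, ← hL]
          gcongr 52 * ?_ * _ * _
          exact Real.exp_le_exp.2 (by nlinarith [mul_pos hγ hR])
  have hV' : M.featureVar (M.policy θ₀) (θ - θs) ≤
      52 * Real.exp (4 * M.γ * R) * d * L / (M.γ ^ 2 * n) := by
    rw [le_div_iff₀ (by positivity)]
    linarith
  -- The variance bound passes from the sampling policy to the target, with the coverage taken at
  -- the current error as radius.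
  have h5 : lam * lpNorm 2 (θ - θs) ^ 2 ≤ M.localCoverage p θs (lpNorm p (θ₀ - θs)) *
      (52 * Real.exp (4 * M.γ * R) * d * L / (M.γ ^ 2 * n)) :=
    (mul_sq_le_featureVar hpsd _).trans ((featureVar_target_le hp hp2 htar θ₀ _).trans
      (mul_le_mul_of_nonneg_left hV' (localCoverage_nonneg _)))
  have h6 : lpNorm 2 (θ - θs) ^ 2 ≤ M.localCoverage p θs (lpNorm p (θ₀ - θs)) *
      (52 * Real.exp (4 * M.γ * R) * d * L / (M.γ ^ 2 * n)) / lam := by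
    rw [le_div_iff₀ hlam]
    linarith
  have hdp : (d : ℝ) ^ (2 / p.toReal) = (d : ℝ) ^ (2 / p.toReal - 1) * d := by
    rw [Real.rpow_sub_one (by positivity), div_mul_cancel₀ _ (by positivity)]
  refine (lpNorm_sq_le hp hp2 _).trans ((mul_le_mul_of_nonneg_left h6 (by positivity)).trans
    (le_of_eq ?_))
  rw [rate, hdp, ← hL]
  field_simp

/-- Histories form a finite type, so the law of one run determines the bound; the joint law of
different runs plays no role. -/
lemma measure_le_of_runProb {n K : ℕ} {est : (k : ℕ) → (Fin k → Fin n → Sample X A) → Fin d → ℝ}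
    {Ω : Type w} [MeasurableSpace Ω] {P : MeasureTheory.Measure Ω}
    {H : Ω → Fin K → Fin n → Sample X A} (htar : M.target = M.policy θs)
    (hH : ∀ h, P {ω | H ω = h} = ENNReal.ofReal (M.runProb est h))
    (Q : (Fin K → Fin n → Sample X A) → Prop) [DecidablePred Q] :
    P {ω | Q (H ω)} ≤ ENNReal.ofReal (∑ h, if Q h then M.runProb est h else 0) := by
  have h1 : {ω | Q (H ω)} ⊆ ⋃ h ∈ univ.filter Q, {ω | H ω = h} := by
    intro ω hω
    simpa using hω
  refine (MeasureTheory.measure_mono h1).trans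
    ((MeasureTheory.measure_biUnion_finset_le _ _).trans ?_)
  rw [← sum_filter, ENNReal.ofReal_sum_of_nonneg fun h _ => runProb_nonneg est htar h]
  exact sum_le_sum fun h _ => (hH h).le

end Bandit

/-! ### Typical runs and the union bound. -/

namespace Bandit

variable {X : Type u} {A : Type v} [Fintype X] [Fintype A] {d : ℕ} {M : Bandit X A d}
  {p : ℝ≥0∞} {θs : Fin d → ℝ}

/-- The data sets that are atypical or impossible. -/
def IsExceptional (M : Bandit X A d) (θs : Fin d → ℝ) (R ε : ℝ) (T : Finset (Fin d → ℝ))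
    (θ₀ : Fin d → ℝ) {n : ℕ} (D : Fin n → Sample X A) : Prop :=
  M.IsAtypical θs R ε T θ₀ D ∨ M.dataProb (M.policy θ₀) D = 0

/-- The guarantee for a run all of whose batches are typical. -/
lemma kl_le_and_sq_le_of_typical (hp : 1 ≤ p) (hp2 : p ≤ 2) (htar : M.target = M.policy θs)
    {c c₀ b κ R lam η δ : ℝ} {K n : ℕ} (hc : 0 < c) (hc₀ : 0 < c₀) (hcκ : c * κ ≤ c₀ ^ 2)
    (hc16 : 16 * c ≤ c₀ ^ 2) (hκ : 1 ≤ κ) (hb0 : 0 ≤ b) (hb : -Real.log c₀ ≤ b)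
    (hcb : c ≤ Real.exp (-(15 * b + 48)))
    (hR : 0 < R) (hlam : 0 < lam) (hη : 0 < η) (hη1 : η < 1) (hδ : 0 < δ)
    (hδ1 : δ < 1) (hsR : θs ∈ lpBall p 0 R)
    (hpsd : (M.cov M.target - lam • (1 : Matrix (Fin d) (Fin d) ℝ)).PosSemidef)
    (hgrowth : M.CoverageGrowth p θs R κ) (hγR : c₀ / M.γ ≤ R)
    {Θ : Set (Fin d → ℝ)} (hΘ : Θ ⊆ lpBall 2 0 R) (hs : θs ∈ Θ)
    {T : Finset (Fin d → ℝ)} (hTcard : (T.card : ℝ) ≤ (2 * R * √d / (1 / (M.γ * n)) + 2) ^ d)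
    (hTnet : ∀ θ, lpNorm 2 θ ≤ R → ∃ t ∈ T, lpNorm 2 (θ - t) ≤ 1 / (M.γ * n))
    {est : (k : ℕ) → (Fin k → Fin n → Sample X A) → Fin d → ℝ} (hest : M.IsOnPolicyDPO Θ n est)
    {h : Fin K → Fin n → Sample X A}
    (hgood : ∀ k : Fin K,
      ¬ M.IsExceptional θs R (δ / (K * (n * (n + 1)))) T
        (est k fun j : Fin k => h (Fin.castLE k.2.le j)) (h k))
    (hn : 1 ≤ M.γ * R * n) (hrate : M.rate p R lam η δ K n ≤ c / M.localCoverage p θs R) :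
    M.kl (M.policy (est K h)) M.target ≤ lpNorm p (est K h - θs) ^ 2 ∧
      lpNorm p (est K h - θs) ^ 2 ≤
        max (Real.exp 1 ^ 2 / M.γ ^ 2 * M.rate p R lam η δ K n) (R ^ 2 * η ^ (2 * K)) := by
  have : Fact (1 ≤ p) := ⟨hp⟩
  have hγ := M.γ_pos
  constructor
  · rw [htar]
    exact (kl_policy_le _ _).trans (pow_le_pow_left₀ (norm_nonneg _) (lpNorm_two_le hp hp2 _) 2)
  have hsR' : lpNorm p (0 - θs) ≤ R := by
    rw [zero_sub, lpNorm, WithLp.toLp_neg, norm_neg]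
    simpa [lpBall] using hsR
  -- For `K = 0` the rate vanishes, and the second term of the maximum is the initial bound `R²`.
  obtain rfl | hK := Nat.eq_zero_or_pos K
  · rw [hest.init]
    refine le_max_of_le_right ?_
    rw [mul_zero, pow_zero, mul_one]
    exact pow_le_pow_left₀ (norm_nonneg _) hsR' 2
  obtain rfl | hd := eq_or_ne d 0
  · rw [Subsingleton.elim (est K h - θs) 0, lpNorm_zero hp, zero_pow two_ne_zero]
    exact le_max_of_le_right (by positivity)
  have hCR : 1 ≤ M.localCoverage p θs R := one_le_localCoverage hp hp2 htar hd hlam hpsd hR.le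
  have hlam1 : lam ≤ 1 := le_one_of_posSemidef hd (π := M.target) (fun x => M.tilt_mem _ x) hpsd
  have hdim : 52 * d ≤ c * n := mul_dim_le_of_rate_le hp hp2 hR hlam hlam1 hη hη1 hδ hδ1 hK hn hd
    (hrate.trans (div_le_self hc.le hCR))
  have hd1 : (1 : ℝ) ≤ d := by exact_mod_cast Nat.one_le_iff_ne_zero.2 hd
  have hc1 : c ≤ 1 := hcb.trans (Real.exp_le_one_iff.2 (by linarith))
  have hn0 : (0 : ℝ) ≤ n := n.cast_nonneg
  have hdn : (d : ℝ) ≤ n := by nlinarith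
  have hlog : 15 * b + 48 ≤ Real.log n := by
    rw [Real.le_log_iff_exp_le (by linarith)]
    have h1 : 1 ≤ Real.exp (-(15 * b + 48)) * n :=
      le_trans (by linarith) (mul_le_mul_of_nonneg_right hcb hn0)
    rw [Real.exp_neg, ← div_eq_inv_mul, le_div_iff₀ (Real.exp_pos _), one_mul] at h1
    exact h1
  have hγR' : c₀ ≤ M.γ * R := by
    rw [div_le_iff₀ hγ] at hγR
    linarith
  -- Truncating the history requires `k ≤ K`; the value 0 beyond `K` is never used by the recursion.
  set r : ℕ → ℝ := fun k => if hk : k ≤ K then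
    lpNorm p (est k (fun j : Fin k => h (Fin.castLE hk j)) - θs) else 0 with hr
  have hrK : r K = lpNorm p (est K h - θs) := by
    simp only [hr, le_refl, dif_pos, Fin.castLE_rfl, id]
  have hr0 (k) : 0 ≤ r k := by
    simp only [hr]
    split_ifs
    · exact norm_nonneg _
    · exact le_rfl
  rw [← hrK]
  refine sq_le_max_of_recursion hc hc₀ hcκ hc16 hκ hγ hR hη hη1
    (rate_nonneg hlam hδ hδ1 hK hn) hγR localCoverage_nonneg (localCoverage_le_exp hp hp2 htar)
    hCR hrate hgrowth hr0 ?_ fun k hk => ?_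
  · simp only [hr, Nat.zero_le, dif_pos, hest.init]
    exact hsR'
  · obtain ⟨hT, hD⟩ := not_or.1 (hgood ⟨k, hk⟩)
    simp only [hr, dif_pos hk.le, dif_pos (Nat.succ_le_of_lt hk)]
    exact lpNorm_sq_le_of_not_isAtypical hp hp2 htar hR hlam hη hδ hδ1 hK hn hd hpsd hc₀ hb0 hb
      hγR' hdn hlog hΘ hs hTcard hTnet (hest.mem k _) (hest.isMin k _) hD hT

open Classical in
-- Impossible batches have weight zero, so excluding them is free. They must be excluded because
-- outside the support of the base policy the DPO loss need not be the logistic loss.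
lemma sum_runProb_atypical_le (htar : M.target = M.policy θs) {R δ : ℝ} (hδ : 0 < δ) {n : ℕ}
    (hn : 1 ≤ n) (hs : lpNorm 2 θs ≤ R) {T : Finset (Fin d → ℝ)} (hT : ∀ t ∈ T, lpNorm 2 t ≤ R)
    (est : (k : ℕ) → (Fin k → Fin n → Sample X A) → Fin d → ℝ) (K : ℕ) :
    (∑ h : Fin K → Fin n → Sample X A, if ∃ k : Fin K,
      M.IsExceptional θs R (δ / (K * (n * (n + 1)))) T
        (est k fun j : Fin k => h (Fin.castLE k.2.le j)) (h k)
      then M.runProb est h else 0) ≤ δ / (n * (n + 1)) := by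
  have hn1 : (1 : ℝ) ≤ n := by exact_mod_cast hn
  obtain rfl | hK := Nat.eq_zero_or_pos K
  · simp only [IsEmpty.exists_iff, if_false, sum_const_zero]
    positivity
  have hK0 : (0 : ℝ) < K := by exact_mod_cast hK
  have e : (K : ℝ) * (δ / (K * (n * (n + 1)))) = δ / (n * (n + 1)) := by
    field_simp
  refine (sum_runProb_exists_le est htar (ε := δ / (K * (n * (n + 1)))) 
    (fun θ D => M.IsExceptional θs R (δ / (K * (n * (n + 1)))) T θ D)
    (fun θ => ?_) K).trans e.le
  refine le_trans (sum_le_sum fun D _ => ?_)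
    (sum_dataProb_isAtypical_le htar (ε := δ / (K * (n * (n + 1)))) (by positivity) hs hT θ n)
  by_cases h1 : M.IsAtypical θs R (δ / (K * (n * (n + 1)))) T θ D
  · simp [IsExceptional, h1]
  · by_cases h2 : M.dataProb (M.policy θ) D = 0 <;> simp [IsExceptional, h1, h2]

end Bandit

end OnPolicyDPO

open OnPolicyDPO OnPolicyDPO.Bandit

theorem mainTheorem1 (c₀ κ : ℝ) (hc₀ : 0 < c₀) (hκ : 1 ≤ κ) :
    ∃ c : ℝ, 0 < c ∧
      ∀ (X : Type u) (A : Type v) [Fintype X] [Fintype A] (d : ℕ)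
        (M : OnPolicyDPO.Bandit X A d) (p : ℝ≥0∞) (R lam η δ : ℝ) (K : ℕ) (θs : Fin d → ℝ),
        1 ≤ p → p ≤ 2 → 0 < R → 0 < lam → 0 < η → η < 1 → 0 < δ → δ < 1 →
        -- realizability
        M.target = M.policy θs → θs ∈ OnPolicyDPO.lpBall p 0 R →
        -- the covariance of the target policy is bounded below
        (M.cov M.target - lam • (1 : Matrix (Fin d) (Fin d) ℝ)).PosSemidef →
        M.CoverageGrowth p θs R κ →
        c₀ / M.γ ≤ min (√(M.localCoverage p θs R)) R →
        -- runs of the algorithm for all batch sizes, over the `L²` ball or over the `L^p` ball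
        ∀ (q : ℝ≥0∞), q = 2 ∨ q = p →
        ∀ (est : (n k : ℕ) → (Fin k → Fin n → OnPolicyDPO.Sample X A) → Fin d → ℝ),
        (∀ n, M.IsOnPolicyDPO (OnPolicyDPO.lpBall q 0 R) n (est n)) →
        ∀ (Ω : Type w) [MeasurableSpace Ω] (P : MeasureTheory.Measure Ω)
          [MeasureTheory.IsProbabilityMeasure P]
          (H : (n : ℕ) → Ω → Fin K → Fin n → OnPolicyDPO.Sample X A),
        (∀ n h, MeasurableSet {ω | H n ω = h} ∧
          P {ω | H n ω = h} = ENNReal.ofReal (M.runProb (est n) h)) →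
        1 - δ ≤ P.real {ω | ∀ n : ℕ, 1 ≤ M.γ * R * n →
          M.rate p R lam η δ K n ≤ c / M.localCoverage p θs R →
          M.kl (M.policy (est n K (H n ω))) M.target
              ≤ OnPolicyDPO.lpNorm p (est n K (H n ω) - θs) ^ 2 ∧
            OnPolicyDPO.lpNorm p (est n K (H n ω) - θs) ^ 2
              ≤ max (Real.exp 1 ^ 2 / M.γ ^ 2 * M.rate p R lam η δ K n)
                  (R ^ 2 * η ^ (2 * K))} := by
  classical
  set b := max 0 (-Real.log c₀) with hb
  have hκ0 : 0 < κ := by linarith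
  -- The three entries serve, in order, to force `log n ≥ 15 b + 48`, to contract on the slow radii,
  -- and to handle the convex case and the floor.
  refine ⟨min (Real.exp (-(15 * b + 48))) (min (c₀ ^ 2 / κ) (c₀ ^ 2 / 16)), by positivity, ?_⟩
  set c := min (Real.exp (-(15 * b + 48))) (min (c₀ ^ 2 / κ) (c₀ ^ 2 / 16)) with hcdef
  have hc : 0 < c := by positivity
  have hcb : c ≤ Real.exp (-(15 * b + 48)) := min_le_left _ _
  have hcκ : c * κ ≤ c₀ ^ 2 :=
    (le_div_iff₀ hκ0).1 ((min_le_right _ _).trans (min_le_left _ _))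
  have hc16 : 16 * c ≤ c₀ ^ 2 := by
    linarith [(min_le_right _ _).trans (min_le_right _ _) |>.trans' hcdef.le]
  intro X A _ _ d M p R lam η δ K θs hp hp2 hR hlam hη hη1 hδ hδ1 htar hsR hpsd hgrowth hmin q hq
    est hest Ω _ P _ H hH
  have hγ := M.γ_pos
  have hγR := hmin.trans (min_le_right _ _)
  have hΘ : lpBall q (0 : Fin d → ℝ) R ⊆ lpBall 2 0 R := by
    rcases hq with rfl | rfl
    · exact subset_rfl
    · exact lpBall_subset hp hp2 _ _
  have hs : θs ∈ lpBall q 0 R := by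
    rcases hq with rfl | rfl
    · exact lpBall_subset hp hp2 _ _ hsR
    · exact hsR
  have hs2 : lpNorm 2 θs ≤ R := by simpa [lpBall] using hΘ hs
  have hnet (n : ℕ) : ∃ T : Finset (Fin d → ℝ), 1 ≤ n → (∀ t ∈ T, lpNorm 2 t ≤ R) ∧
      (T.card : ℝ) ≤ (2 * R * √d / (1 / (M.γ * n)) + 2) ^ d ∧
      ∀ θ, lpNorm 2 θ ≤ R → ∃ t ∈ T, lpNorm 2 (θ - t) ≤ 1 / (M.γ * n) := by
    by_cases hn : 1 ≤ n
    · have hn0 : (0 : ℝ) < n := by exact_mod_cast hn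
      obtain ⟨T, hT⟩ := exists_net d hR (ε := 1 / (M.γ * n)) (by positivity)
      exact ⟨T, fun _ => hT⟩
    · exact ⟨∅, fun h => absurd h hn⟩
  choose T hT using hnet
  set Bad : (n : ℕ) → (Fin K → Fin n → Sample X A) → Prop := fun n h => ∃ k : Fin K,
    M.IsExceptional θs R (δ / (K * (n * (n + 1)))) (T n)
      (est n k fun j : Fin k => h (Fin.castLE k.2.le j)) (h k)
    with hBad
  set S := {ω | ∀ n : ℕ, 1 ≤ M.γ * R * n →
          M.rate p R lam η δ K n ≤ c / M.localCoverage p θs R →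
          M.kl (M.policy (est n K (H n ω))) M.target
              ≤ OnPolicyDPO.lpNorm p (est n K (H n ω) - θs) ^ 2 ∧
            OnPolicyDPO.lpNorm p (est n K (H n ω) - θs) ^ 2
              ≤ max (Real.exp 1 ^ 2 / M.γ ^ 2 * M.rate p R lam η δ K n)
                  (R ^ 2 * η ^ (2 * K))} with hS
  have hsub : Sᶜ ⊆ ⋃ m : ℕ, {ω | Bad (m + 1) (H (m + 1) ω)} := by
    intro ω hω
    by_contra hnot
    refine hω fun n hn hrate => ?_
    have hn1 : 1 ≤ n := by
      by_contra! h0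
      obtain rfl : n = 0 := by omega
      simp at hn
      linarith
    obtain ⟨m, rfl⟩ := Nat.exists_eq_add_of_le' hn1
    have hgood : ¬ Bad (m + 1) (H (m + 1) ω) := fun h => hnot (Set.mem_iUnion.2 ⟨m, h⟩)
    obtain ⟨-, hcard, hTn⟩ := hT (m + 1) hn1
    exact kl_le_and_sq_le_of_typical hp hp2 htar hc hc₀ hcκ hc16 hκ (le_max_left _ _)
      (le_max_right _ _) hcb hR hlam hη hη1 hδ hδ1 hsR hpsd hgrowth hγR hΘ hs hcard hTn
      (hest (m + 1)) (not_exists.1 hgood) hn hrate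
  have hPbad (m : ℕ) : P {ω | Bad (m + 1) (H (m + 1) ω)} ≤
      ENNReal.ofReal (δ / (((m + 1 : ℕ) : ℝ) * ((m + 1 : ℕ) + 1))) :=
    (measure_le_of_runProb htar (fun h => (hH (m + 1) h).2) (Bad (m + 1))).trans
      (ENNReal.ofReal_le_ofReal (sum_runProb_atypical_le htar hδ (by omega) hs2
        (hT (m + 1) (by omega)).1 (est (m + 1)) K))
  have hcompl : P Sᶜ ≤ ENNReal.ofReal δ := by
    refine (MeasureTheory.measure_mono hsub).trans ((MeasureTheory.measure_iUnion_le _).trans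
      ((ENNReal.tsum_le_tsum hPbad).trans (ENNReal.tsum_le_of_sum_range_le fun N => ?_)))
    rw [← ENNReal.ofReal_sum_of_nonneg fun m _ => by positivity]
    exact ENNReal.ofReal_le_ofReal (sum_range_div_mul_le N hδ.le)
  have hreal : P.real Sᶜ ≤ δ := by
    rw [MeasureTheory.measureReal_def]
    exact ENNReal.toReal_le_of_le_ofReal hδ.le hcompl
  -- Subadditivity suffices in this direction, so measurability of `S` is not needed.
  have huniv : 1 ≤ P.real S + P.real Sᶜ := by
    have h := MeasureTheory.measureReal_union_le (μ := P) S Sᶜ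
    rwa [Set.union_compl_self, MeasureTheory.probReal_univ] at h
  linarith
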